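/- Let $G(2,4)$ be the Grassmannian of two-dimensional linear subspaces $\ell\subset\mathbb C^4$ (lines in $\mathbb P^3$), regarded as a complex algebraic variety, and let $K^0(G(2,4))$ be the Grothendieck ring of algebraic vector bundles on it: the abelian group generated by the classes $[E]$ of vector bundles, with $[E]=[E']+[E'']$ for every short exact sequence $0\to E'\to E\to E''\to 0$, and with product $[E][F]=[E\otimes F]$. Let $\nu$ be the rank $2$ vector bundle on $G(2,4)$ whose fibre at $\ell$ is the space of linear functionals on $\mathbb C^4$ that vanish on $\ell$ (the dual of the tautological quotient bundle). For integers $k\ge 1$ and $d\ge 0$ let $V_{k,d}$ be the vector bundle on $G(2,4)$ whose fibre at $\ell$ is the space of homogeneous polynomials of degree $d$ in four variables that vanish on $\ell$ to order $k$, that is, that lie in the $k$-th power of the ideal of polynomials vanishing on $\ell$; it is a subbundle of the trivial bundle of homogeneous polynomials of degree $d$. Then, for all integers $k\ge 1$ and $d\ge 0$, $$[V_{k,d}]=\binom{d-k+3}{3}[\mathrm{Sym}^k\nu]-\binom{d-k+2}{3}[\wedge^2\nu]\,[\mathrm{Sym}^{k-1}\nu]\quad\text{in }K^0(G(2,4)),$$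 where $\binom{n}{3}$ is the usual binomial coefficient for integers $n\ge 0$ (zero for $0\le n<3$) and $\binom{n}{3}=0$ for $n<0$. -/

import Mathlib

open scoped Topology TensorProduct
open Filter

noncomputable section

/-- A complex space with functions (in the sense of classical algebraic geometry): a topological
space with, for every point `x`, the algebra of those complex functions that are regular at `x`
(a function is regular on an open set when it is regular at each of its points). Only the germ at
`x` of a function matters; its values far away from `x` are irrelevant. -/
class SpaceWithFunctions (X : Type) extends TopologicalSpace X where
  regAt : X → Subalgebra ℂ (X → ℂ)
  regAt_congr : ∀ {x : X} {f g : X → ℂ}, f =ᶠ[𝓝 x] g → f ∈ regAt x → g ∈ regAt x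
  regAt_eventually : ∀ {x : X} {f : X → ℂ}, f ∈ regAt x → ∀ᶠ y in 𝓝 x, f ∈ regAt y
  eventually_ne_zero : ∀ {x : X} {f : X → ℂ}, f ∈ regAt x → f x ≠ 0 → ∀ᶠ y in 𝓝 x, f y ≠ 0
  regAt_inv : ∀ {x : X} {f : X → ℂ}, f ∈ regAt x → f x ≠ 0 → f⁻¹ ∈ regAt x

open SpaceWithFunctions

/-- Near `y`, the section `s` is a linear combination of the sections `e i` whose coefficients are
functions regular at `y`. -/
def HasCoords {X : Type} [SpaceWithFunctions X] {F : X → Type} [∀ x, AddCommGroup (F x)]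
    [∀ x, Module ℂ (F x)] {ι : Type} [Fintype ι] (e : ι → ∀ x, F x) (y : X) (s : ∀ x, F x) :
    Prop :=
  ∃ c : ι → X → ℂ, (∀ i, c i ∈ regAt y) ∧ ∀ᶠ z in 𝓝 y, s z = ∑ i, c i z • e i z

/-- An algebraic vector bundle (of finite rank): a family of complex vector spaces together with the
predicate "the section `s` is regular at `x`", such that every point has a neighbourhood with a
frame: finitely many sections which form a basis of every fibre over the neighbourhood, and such
that a section is regular at a point of the neighbourhood exactly when its coordinates are.
The regular sections form the locally free sheaf of the bundle. -/
structure AlgVectorBundle (X : Type) [SpaceWithFunctions X] where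
  fiber : X → Type
  [acg : ∀ x, AddCommGroup (fiber x)]
  [mod : ∀ x, Module ℂ (fiber x)]
  IsReg : X → (∀ x, fiber x) → Prop
  exists_frame : ∀ x, ∃ (ι : Type) (_ : Fintype ι) (e : ι → ∀ y, fiber y), ∀ᶠ y in 𝓝 x,
    LinearIndependent ℂ (fun i => e i y) ∧ ⊤ ≤ Submodule.span ℂ (Set.range fun i => e i y) ∧
      ∀ s, IsReg y s ↔ HasCoords e y s

namespace HasCoords

variable {X : Type} [SpaceWithFunctions X] {F : X → Type} [∀ x, AddCommGroup (F x)]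
    [∀ x, Module ℂ (F x)] {ι : Type} [Fintype ι] {e : ι → ∀ x, F x} {y : X} {s t : ∀ x, F x}

theorem zero : HasCoords e y 0 :=
  ⟨fun _ => 0, fun _ => zero_mem _, Eventually.of_forall fun z => by simp⟩

theorem add (hs : HasCoords e y s) (ht : HasCoords e y t) :
    HasCoords e y (fun z => s z + t z) := by
  obtain ⟨c, hc, h⟩ := hs
  obtain ⟨c', hc', h'⟩ := ht
  refine ⟨fun i => c i + c' i, fun i => add_mem (hc i) (hc' i), ?_⟩
  filter_upwards [h, h'] with z hz hz'
  simp [hz, hz', add_smul, Finset.sum_add_distrib]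

theorem smul {f : X → ℂ} (hf : f ∈ regAt y) (hs : HasCoords e y s) :
    HasCoords e y (fun z => f z • s z) := by
  obtain ⟨c, hc, h⟩ := hs
  refine ⟨fun i => f * c i, fun i => mul_mem hf (hc i), ?_⟩
  filter_upwards [h] with z hz
  simp [hz, mul_smul, Finset.smul_sum]

theorem congr (h : ∀ᶠ z in 𝓝 y, s z = t z) (hs : HasCoords e y s) : HasCoords e y t := by
  obtain ⟨c, hc, h'⟩ := hs
  refine ⟨c, hc, ?_⟩
  filter_upwards [h, h'] with z hz hz'
  rw [← hz, hz']

theorem eventually (hs : HasCoords e y s) : ∀ᶠ z in 𝓝 y, HasCoords e z s := by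
  obtain ⟨c, hc, h⟩ := hs
  have h1 : ∀ᶠ z in 𝓝 y, ∀ i, c i ∈ regAt z := eventually_all.2 fun i => regAt_eventually (hc i)
  filter_upwards [h1, eventually_eventually_nhds.2 h] with z hz hz'
  exact ⟨c, hz, hz'⟩

theorem single (i : ι) : HasCoords e y (e i) := by
  classical
  refine ⟨fun j => if j = i then 1 else 0, fun j => ?_, Eventually.of_forall fun z => ?_⟩
  · dsimp only
    split_ifs
    exacts [one_mem _, zero_mem _]
  · rw [Finset.sum_eq_single i] <;> simp +contextual

theorem sum {κ : Type} (S : Finset κ) {s : κ → ∀ x, F x} (h : ∀ k ∈ S, HasCoords e y (s k)) :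
    HasCoords e y (fun z => ∑ k ∈ S, s k z) := by
  classical
  induction S using Finset.induction_on with
  | empty => exact zero
  | insert a S ha ih =>
    simp only [Finset.sum_insert ha]
    exact add (h _ (by simp)) (ih fun k hk => h k (by simp [hk]))

end HasCoords

/-- The smallest family of germs of sections at `x` that contains `gen x` and is closed under linear
combinations whose coefficients are regular at `x`. -/
inductive GenReg {X : Type} [SpaceWithFunctions X] {F : X → Type} [∀ x, AddCommGroup (F x)]
    [∀ x, Module ℂ (F x)] (gen : X → Set (∀ x, F x)) (x : X) : (∀ x, F x) → Prop
  | of (s : ∀ x, F x) : s ∈ gen x → GenReg gen x s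
  | zero : GenReg gen x 0
  | add (s t : ∀ x, F x) : GenReg gen x s → GenReg gen x t → GenReg gen x (fun y => s y + t y)
  | smul (f : X → ℂ) (s : ∀ x, F x) :
      f ∈ regAt x → GenReg gen x s → GenReg gen x (fun y => f y • s y)
  | congr (s t : ∀ x, F x) : (∀ᶠ y in 𝓝 x, s y = t y) → GenReg gen x s → GenReg gen x t

theorem GenReg.hasCoords {X : Type} [SpaceWithFunctions X] {F : X → Type}
    [∀ x, AddCommGroup (F x)] [∀ x, Module ℂ (F x)] {gen : X → Set (∀ x, F x)} {x : X}
    {ι : Type} [Fintype ι] {e : ι → ∀ x, F x} (h : ∀ s ∈ gen x, HasCoords e x s)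
    {s : ∀ x, F x} (hs : GenReg gen x s) : HasCoords e x s := by
  induction hs with
  | of s hs => exact h s hs
  | zero => exact HasCoords.zero
  | add s t _ _ hs ht => exact hs.add ht
  | smul f s hf _ hs => exact hs.smul hf
  | congr s t hst _ hs => exact hs.congr hst

theorem GenReg.sum {X : Type} [SpaceWithFunctions X] {F : X → Type}
    [∀ x, AddCommGroup (F x)] [∀ x, Module ℂ (F x)] {gen : X → Set (∀ x, F x)} {x : X}
    {κ : Type} (S : Finset κ) {s : κ → ∀ x, F x} (h : ∀ k ∈ S, GenReg gen x (s k)) :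
    GenReg gen x (fun z => ∑ k ∈ S, s k z) := by
  classical
  induction S using Finset.induction_on with
  | empty => exact GenReg.zero
  | insert a S ha ih =>
    simp only [Finset.sum_insert ha]
    exact GenReg.add _ _ (h _ (by simp)) (ih fun k hk => h k (by simp [hk]))

namespace AlgVectorBundle

variable {X : Type} [SpaceWithFunctions X]

instance instAcg (E : AlgVectorBundle X) (x : X) : AddCommGroup (E.fiber x) := E.acg x

instance instMod (E : AlgVectorBundle X) (x : X) : Module ℂ (E.fiber x) := E.mod x

/-- The bundle with given fibres whose regular sections are generated by a given family of
sections. -/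
def ofGen (F : X → Type) [∀ x, AddCommGroup (F x)] [∀ x, Module ℂ (F x)]
    (gen : X → Set (∀ x, F x))
    (h : ∀ x, ∃ (ι : Type) (_ : Fintype ι) (e : ι → ∀ y, F y), ∀ᶠ y in 𝓝 x,
      LinearIndependent ℂ (fun i => e i y) ∧ ⊤ ≤ Submodule.span ℂ (Set.range fun i => e i y) ∧
        (∀ i, e i ∈ gen y) ∧ ∀ s ∈ gen y, HasCoords e y s) : AlgVectorBundle X where
  fiber := F
  IsReg := GenReg gen
  exists_frame x := by
    obtain ⟨ι, _, e, he⟩ := h x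
    refine ⟨ι, inferInstance, e, ?_⟩
    filter_upwards [he] with y hy
    refine ⟨hy.1, hy.2.1, fun s => ⟨fun hs => hs.hasCoords hy.2.2.2, ?_⟩⟩
    rintro ⟨c, hc, hs⟩
    refine GenReg.congr (fun z => ∑ i, c i z • e i z) _ (hs.mono fun z hz => hz.symm) ?_
    exact GenReg.sum _ fun i _ => GenReg.smul _ _ (hc i) (GenReg.of _ (hy.2.2.1 i))

section Basic

variable (E : AlgVectorBundle X) {x : X} {s t : ∀ x, E.fiber x}

theorem exists_frame_at (x : X) : ∃ (ι : Type) (_ : Fintype ι) (e : ι → ∀ y, E.fiber y),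
    ∀ s, E.IsReg x s ↔ HasCoords e x s := by
  obtain ⟨ι, i, e, h⟩ := E.exists_frame x
  exact ⟨ι, i, e, h.self_of_nhds.2.2⟩

theorem isReg_zero : E.IsReg x 0 := by
  obtain ⟨ι, _, e, h⟩ := E.exists_frame_at x
  exact (h _).2 HasCoords.zero

variable {E}

theorem IsReg.add (hs : E.IsReg x s) (ht : E.IsReg x t) : E.IsReg x (fun y => s y + t y) := by
  obtain ⟨ι, _, e, h⟩ := E.exists_frame_at x
  exact (h _).2 (((h _).1 hs).add ((h _).1 ht))

theorem IsReg.smul {f : X → ℂ} (hf : f ∈ regAt x) (hs : E.IsReg x s) :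
    E.IsReg x (fun y => f y • s y) := by
  obtain ⟨ι, _, e, h⟩ := E.exists_frame_at x
  exact (h _).2 (((h _).1 hs).smul hf)

theorem IsReg.congr (hst : ∀ᶠ y in 𝓝 x, s y = t y) (hs : E.IsReg x s) : E.IsReg x t := by
  obtain ⟨ι, _, e, h⟩ := E.exists_frame_at x
  exact (h _).2 (((h _).1 hs).congr hst)

end Basic

/-- A morphism of vector bundles: a family of linear maps that sends regular sections to regular
sections. -/
structure Hom (E F : AlgVectorBundle X) where
  toFun : ∀ x, E.fiber x →ₗ[ℂ] F.fiber x
  map_reg : ∀ x s, E.IsReg x s → F.IsReg x (fun y => toFun y (s y))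

/-- `0 → E → F → G → 0` is exact. For vector bundles this is exactness on all fibres. -/
def IsShortExact {E F G : AlgVectorBundle X} (f : Hom E F) (g : Hom F G) : Prop :=
  ∀ x, Function.Injective (f.toFun x) ∧ Function.Exact (f.toFun x) (g.toFun x) ∧
    Function.Surjective (g.toFun x)

/-- The zero bundle. -/
def zeroBundle (X : Type) [SpaceWithFunctions X] : AlgVectorBundle X where
  fiber _ := PUnit
  IsReg _ _ := True
  exists_frame x := ⟨Empty, inferInstance, fun i => i.elim, Eventually.of_forall fun y =>
    ⟨linearIndependent_empty_type, fun v _ => by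
      rw [Subsingleton.elim v 0]; exact zero_mem _,
      fun s => ⟨fun _ => ⟨fun i => i.elim, fun i => i.elim, Eventually.of_forall fun z =>
        Subsingleton.elim _ _⟩, fun _ => trivial⟩⟩⟩

/-- The trivial line bundle (the structure sheaf). -/
def unitBundle (X : Type) [SpaceWithFunctions X] : AlgVectorBundle X where
  fiber _ := ℂ
  IsReg x s := s ∈ regAt x
  exists_frame x := ⟨Unit, inferInstance, fun _ _ => 1, Eventually.of_forall fun y =>
    ⟨LinearIndependent.of_subsingleton () one_ne_zero, fun v _ => by
      rw [Set.range_const]; exact Submodule.mem_span_singleton.2 ⟨v, by simp⟩,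
      fun s => ⟨fun h => ⟨fun _ => s, fun _ => h, Eventually.of_forall fun z => by simp⟩,
        fun ⟨c, hc, h⟩ => regAt_congr (f := c ()) (h.mono fun z hz => by simp [hz]) (hc ())⟩⟩⟩

/-- The sections that generate the tensor product: tensor products of regular sections. -/
def tensorGen (E F : AlgVectorBundle X) (x : X) : Set (∀ y, E.fiber y ⊗[ℂ] F.fiber y) :=
  {s | ∃ a b, E.IsReg x a ∧ F.IsReg x b ∧ s = fun y => a y ⊗ₜ[ℂ] b y}

/-- The tensor product of two bundles. -/
def tensor (E F : AlgVectorBundle X) : AlgVectorBundle X :=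
  ofGen (fun x => E.fiber x ⊗[ℂ] F.fiber x) (tensorGen E F) (by
    intro x
    obtain ⟨ι, _, e, he⟩ := E.exists_frame x
    obtain ⟨κ, _, f, hf⟩ := F.exists_frame x
    refine ⟨ι × κ, inferInstance, fun p y => e p.1 y ⊗ₜ f p.2 y, ?_⟩
    filter_upwards [he, hf] with y ⟨he1, he2, he3⟩ ⟨hf1, hf2, hf3⟩
    have hb : (fun p : ι × κ => e p.1 y ⊗ₜ[ℂ] f p.2 y) =
        (Module.Basis.mk he1 he2).tensorProduct (Module.Basis.mk hf1 hf2) := by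
      ext p
      simp [Module.Basis.tensorProduct_apply']
    refine ⟨?_, ?_, fun p => ⟨e p.1, f p.2, (he3 _).2 (.single _), (hf3 _).2 (.single _), rfl⟩, ?_⟩
    · rw [hb]
      exact Module.Basis.linearIndependent _
    · rw [hb]
      exact (Module.Basis.span_eq _).ge
    · rintro _ ⟨a, b, ha, hb, rfl⟩
      obtain ⟨c, hc, hac⟩ := (he3 _).1 ha
      obtain ⟨d, hd, hbd⟩ := (hf3 _).1 hb
      refine ⟨fun p => c p.1 * d p.2, fun p => mul_mem (hc _) (hd _), ?_⟩
      filter_upwards [hac, hbd] with z hz hz'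
      rw [hz, hz', TensorProduct.sum_tmul, Fintype.sum_prod_type]
      simp [TensorProduct.tmul_sum, ← TensorProduct.smul_tmul', smul_smul, mul_comm])

/-- The sections that generate the exterior power: wedge products of regular sections. -/
def extGen (E : AlgVectorBundle X) (n : ℕ) (x : X) : Set (∀ y, ⋀[ℂ]^n (E.fiber y)) :=
  {s | ∃ a : Fin n → ∀ y, E.fiber y, (∀ j, E.IsReg x (a j)) ∧
    s = fun y => exteriorPower.ιMulti ℂ n (fun j => a j y)}

/-- The exterior powers of a bundle. -/
def extPow (n : ℕ) (E : AlgVectorBundle X) : AlgVectorBundle X :=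
  ofGen (fun x => ⋀[ℂ]^n (E.fiber x)) (extGen E n) (by
    classical
    intro x
    obtain ⟨ι, _, e, he⟩ := E.exists_frame x
    let _ : LinearOrder ι := IsWellOrder.linearOrder (WellOrderingRel (α := ι))
    refine ⟨Set.powersetCard ι n, inferInstance, fun p y =>
      exteriorPower.ιMulti_family ℂ n (fun i => e i y) p, ?_⟩
    filter_upwards [he, eventually_eventually_nhds.2 he] with y ⟨he1, he2, he3⟩ hev
    have hb : ∀ z (h1 : LinearIndependent ℂ (fun i => e i z))
        (h2 : ⊤ ≤ Submodule.span ℂ (Set.range fun i => e i z)),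
        exteriorPower.ιMulti_family ℂ n (fun i => e i z) =
          (Module.Basis.mk h1 h2).exteriorPower n := by
      intro z h1 h2
      rw [exteriorPower.coe_basis, Module.Basis.coe_mk]
    refine ⟨?_, ?_, fun p => ⟨_, fun j => (he3 _).2 (.single _), rfl⟩, ?_⟩
    · rw [hb y he1 he2]
      exact Module.Basis.linearIndependent _
    · rw [hb y he1 he2]
      exact (Module.Basis.span_eq _).ge
    · rintro _ ⟨a, ha, rfl⟩
      choose c hc hac using fun j => (he3 _).1 (ha j)
      refine ⟨fun p => (Matrix.of fun i j =>
        c i (Set.powersetCard.ofFinEmbEquiv.symm p j)).det, fun p => ?_, ?_⟩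
      · dsimp only
        rw [Matrix.det_apply]
        exact sum_mem fun σ _ => zsmul_mem (prod_mem fun i _ => hc _ _) _
      · filter_upwards [hev, eventually_all.2 hac] with z ⟨hz1, hz2, _⟩ hz
        rw [hb z hz1 hz2]
        conv_lhs => rw [← ((Module.Basis.mk hz1 hz2).exteriorPower n).sum_repr
          (exteriorPower.ιMulti ℂ n fun j => a j z)]
        refine Finset.sum_congr rfl fun p _ => ?_
        congr 1
        rw [exteriorPower.basis_repr_apply, exteriorPower.ιMultiDual_apply_ιMulti, Matrix.det_apply,
          Matrix.det_apply, Finset.sum_apply]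
        refine Finset.sum_congr rfl fun σ _ => ?_
        rw [Pi.smul_apply, Finset.prod_apply]
        congr 1
        refine Finset.prod_congr rfl fun i _ => ?_
        have h : a (σ i) z = ∑ k, c (σ i) k z • Module.Basis.mk hz1 hz2 k := by
          rw [hz]; simp
        simp only [Matrix.of_apply, Module.Basis.coord_apply, h]
        rw [Module.Basis.repr_sum_self])

/-- The `k`-th symmetric power of a complex vector space: the degree `k` part of its symmetric
algebra, spanned by the products of `k` vectors. -/
abbrev SymPart (k : ℕ) (M : Type) [AddCommGroup M] [Module ℂ M] :
    Submodule ℂ (SymmetricAlgebra ℂ M) :=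
  LinearMap.range (SymmetricAlgebra.ι ℂ M) ^ k

/-- The product of `k` vectors in the `k`-th symmetric power. -/
def symMul {M : Type} [AddCommGroup M] [Module ℂ M] {k : ℕ} (v : Fin k → M) : SymPart k M :=
  ⟨∏ j, SymmetricAlgebra.ι ℂ M (v j), by
    induction k with
    | zero => simp [SymPart]
    | succ k ih =>
      rw [Fin.prod_univ_succ, SymPart, pow_succ']
      exact Submodule.mul_mem_mul ⟨_, rfl⟩ (ih _)⟩

/-- The sections that generate the symmetric power: products of regular sections. -/
def symGen (E : AlgVectorBundle X) (k : ℕ) (x : X) : Set (∀ y, SymPart k (E.fiber y)) :=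
  {s | ∃ a : Fin k → ∀ y, E.fiber y, (∀ j, E.IsReg x (a j)) ∧ s = fun y => symMul fun j => a j y}

theorem exists_fun_of_degree {ι : Type} [Fintype ι] [DecidableEq ι] {k : ℕ}
    (J : Finset.finsuppAntidiag (Finset.univ : Finset ι) k) :
    ∃ f : Fin k → ι, J.1 = ∑ j, Finsupp.single (f j) 1 := by
  obtain ⟨J, hJ⟩ := J
  rw [Finset.mem_finsuppAntidiag] at hJ
  have h : J.toMultiset.toList.length = k := by
    rw [Multiset.length_toList, Finsupp.card_toMultiset, ← hJ.1]
    exact Finsupp.sum_fintype _ _ fun _ => rfl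
  subst h
  refine ⟨J.toMultiset.toList.get, ?_⟩
  apply Multiset.toFinsupp.symm.injective
  simp only [Multiset.toFinsupp_symm_apply]
  simp only [map_sum, Finsupp.toMultiset_single, one_smul]
  conv_lhs => rw [← Multiset.coe_toList J.toMultiset, ← List.ofFn_get J.toMultiset.toList,
    ← Fin.univ_val_map, ← Multiset.sum_map_singleton (Multiset.map _ _), Multiset.map_map]
  rfl

/-- The symmetric powers of a bundle. -/
def symPow (k : ℕ) (E : AlgVectorBundle X) : AlgVectorBundle X :=
  ofGen (fun x => SymPart k (E.fiber x)) (symGen E k) (by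
    classical
    intro x
    obtain ⟨ι, _, e, he⟩ := E.exists_frame x
    choose f hf using exists_fun_of_degree (ι := ι) (k := k)
    have hmon : ∀ J, (∏ j, MvPolynomial.X (f J j)) = MvPolynomial.monomial (R := ℂ) J.1 1 := by
      intro J
      conv_rhs => rw [hf J, MvPolynomial.monomial_sum_one]
      rfl
    have hsym : ∀ (z : X) (P : MvPolynomial ι ℂ), P.IsHomogeneous k →
        MvPolynomial.aeval (fun i => SymmetricAlgebra.ι ℂ (E.fiber z) (e i z)) P =
          ∑ J, P.coeff (J : Finset.finsuppAntidiag (Finset.univ : Finset ι) k).1 •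
            (symMul (fun j => e (f J j) z) : SymPart k (E.fiber z)).1 := by
      intro z P hP
      have h1 : P = ∑ J : Finset.finsuppAntidiag (Finset.univ : Finset ι) k,
          P.coeff J.1 • MvPolynomial.monomial J.1 1 := by
        rw [Finset.sum_coe_sort (Finset.finsuppAntidiag (Finset.univ : Finset ι) k)
          (fun J => P.coeff J • MvPolynomial.monomial J (1 : ℂ))]
        ext K
        simp only [MvPolynomial.coeff_sum, MvPolynomial.coeff_smul, MvPolynomial.coeff_monomial,
          smul_eq_mul, mul_ite, mul_one, mul_zero, Finset.sum_ite_eq']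
        split_ifs with hK
        · rfl
        · apply hP.coeff_eq_zero
          intro hd
          apply hK
          rw [Finset.mem_finsuppAntidiag]
          exact ⟨by rw [← hd, Finsupp.degree_eq_sum], Finset.subset_univ _⟩
      conv_lhs => rw [h1]
      rw [map_sum]
      refine Finset.sum_congr rfl fun J _ => ?_
      rw [map_smul, ← hmon, map_prod]
      simp [symMul]
    refine ⟨Finset.finsuppAntidiag (Finset.univ : Finset ι) k, inferInstance,
      fun J y => symMul fun j => e (f J j) y, ?_⟩
    filter_upwards [he] with y ⟨he1, he2, he3⟩
    have hsymm : ∀ P, (SymmetricAlgebra.equivMvPolynomial (Module.Basis.mk he1 he2)).symm P =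
        MvPolynomial.aeval (fun i => SymmetricAlgebra.ι ℂ (E.fiber y) (e i y)) P := by
      intro P
      rw [← AlgEquiv.coe_toAlgHom]
      congr 1
      apply MvPolynomial.algHom_ext
      intro i
      simp
    refine ⟨?_, ?_, fun J => ⟨_, fun j => (he3 _).2 (.single _), rfl⟩, ?_⟩
    · have h := (Module.Basis.mk he1 he2).symmetricAlgebra.linearIndependent.comp
        (fun J : Finset.finsuppAntidiag (Finset.univ : Finset ι) k => J.1) Subtype.val_injective
      refine LinearIndependent.of_comp (SymPart k (E.fiber y)).subtype ?_
      convert h using 1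
      · funext J
        simp only [Function.comp_apply, Submodule.subtype_apply, Module.Basis.symmetricAlgebra,
          Module.Basis.map_apply, MvPolynomial.coe_basisMonomials, AlgEquiv.toLinearEquiv_apply]
        rw [hsymm, ← hmon, map_prod]
        simp [symMul]
      · rfl
    · rintro ⟨v, hv⟩ -
      obtain ⟨P, hP, rfl⟩ : ∃ P : MvPolynomial ι ℂ, P.IsHomogeneous k ∧
          MvPolynomial.aeval (fun i => SymmetricAlgebra.ι ℂ (E.fiber y) (e i y)) P = v := by
        have h1 : LinearMap.range (SymmetricAlgebra.ι ℂ (E.fiber y)) ≤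
            (MvPolynomial.homogeneousSubmodule ι ℂ 1).map (MvPolynomial.aeval
              (fun i => SymmetricAlgebra.ι ℂ (E.fiber y) (e i y))).toLinearMap := by
          rintro _ ⟨w, rfl⟩
          have hw := he2 (Submodule.mem_top (x := w))
          induction hw using Submodule.span_induction with
          | mem w hw =>
            obtain ⟨i, rfl⟩ := hw
            exact ⟨MvPolynomial.X i, MvPolynomial.isHomogeneous_X _ _, by simp⟩
          | zero => rw [map_zero]; exact zero_mem _
          | add a b _ _ ha hb => rw [map_add]; exact add_mem ha hb
          | smul c a _ ha => rw [map_smul]; exact Submodule.smul_mem _ _ ha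
        have h2 := pow_le_pow_left' h1 k hv
        rw [← Submodule.map_pow, MvPolynomial.homogeneousSubmodule_one_pow] at h2
        exact h2
      have h3 : (⟨_, hv⟩ : SymPart k (E.fiber y)) =
          ∑ J, P.coeff (J : Finset.finsuppAntidiag (Finset.univ : Finset ι) k).1 •
            symMul (fun j => e (f J j) y) := by
        apply Subtype.ext
        refine (hsym y P hP).trans ?_
        simp
      rw [h3]
      exact sum_mem fun J _ => Submodule.smul_mem _ _ (Submodule.subset_span ⟨J, rfl⟩)
    · rintro _ ⟨a, ha, rfl⟩
      choose c hc hac using fun j => (he3 _).1 (ha j)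
      let P : MvPolynomial ι (SpaceWithFunctions.regAt y) :=
        ∏ j, ∑ i, MvPolynomial.C ⟨c j i, hc j i⟩ * MvPolynomial.X i
      refine ⟨fun J => (P.coeff J.1).1, fun J => (P.coeff J.1).2, ?_⟩
      filter_upwards [eventually_all.2 hac] with z hz
      let ev : SpaceWithFunctions.regAt y →+* ℂ :=
        (Pi.evalRingHom (fun _ : X => ℂ) z).comp (SpaceWithFunctions.regAt y).val.toRingHom
      have hP : (P.map ev) = ∏ j, ∑ i, MvPolynomial.C (c j i z) * MvPolynomial.X i := by
        simp [P, ev]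
      have hPh : (P.map ev).IsHomogeneous k := by
        rw [hP]
        have := MvPolynomial.IsHomogeneous.prod (Finset.univ : Finset (Fin k))
          (fun j => ∑ i, MvPolynomial.C (c j i z) * MvPolynomial.X i) (fun _ => 1)
          (fun j _ => MvPolynomial.IsHomogeneous.sum _ _ _
            fun i _ => MvPolynomial.isHomogeneous_C_mul_X _ _)
        simpa using this
      have h := hsym z _ hPh
      apply Subtype.ext
      simp only [MvPolynomial.coeff_map] at h
      refine Eq.trans ?_ (h.trans ?_)
      · rw [hP]
        simp [symMul, hz, Algebra.smul_def]
      · simp [ev])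

/-! ### K-theory of vector bundles -/

/-- The relations of the Grothendieck group: `[E] - [E'] - [E'']` for every short exact sequence
`0 → E' → E → E'' → 0` of vector bundles. -/
def K0Rel (X : Type) [SpaceWithFunctions X] : Set (FreeAbelianGroup (AlgVectorBundle X)) :=
  {r | ∃ (E' E E'' : AlgVectorBundle X) (f : Hom E' E) (g : Hom E E''), IsShortExact f g ∧
    r = FreeAbelianGroup.of E - FreeAbelianGroup.of E' - FreeAbelianGroup.of E''}

end AlgVectorBundle

open AlgVectorBundle

/-- The Grothendieck group of vector bundles on `X`. -/
def K0 (X : Type) [SpaceWithFunctions X] : Type 1 :=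
  FreeAbelianGroup (AlgVectorBundle X) ⧸ AddSubgroup.closure (K0Rel X)

namespace K0

variable {X : Type} [SpaceWithFunctions X]

instance : AddCommGroup (K0 X) :=
  inferInstanceAs (AddCommGroup
    (FreeAbelianGroup (AlgVectorBundle X) ⧸ AddSubgroup.closure (K0Rel X)))

/-- The class of a vector bundle. -/
def cls (E : AlgVectorBundle X) : K0 X :=
  QuotientAddGroup.mk' (AddSubgroup.closure (K0Rel X)) (FreeAbelianGroup.of E)

theorem cls_exact {E' E E'' : AlgVectorBundle X} (f : Hom E' E) (g : Hom E E'')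
    (h : IsShortExact f g) : cls E = cls E' + cls E'' := by
  have h1 : QuotientAddGroup.mk' (AddSubgroup.closure (K0Rel X))
      (FreeAbelianGroup.of E - FreeAbelianGroup.of E' - FreeAbelianGroup.of E'') = 0 :=
    (QuotientAddGroup.eq_zero_iff _).2 (AddSubgroup.subset_closure ⟨E', E, E'', f, g, h, rfl⟩)
  rw [map_sub, map_sub, sub_sub, sub_eq_zero] at h1
  exact h1

/-- An additive function on bundles induces a homomorphism on the Grothendieck group. -/
def lift {A : Type 1} [AddCommGroup A] (φ : AlgVectorBundle X → A)
    (h : ∀ (E' E E'' : AlgVectorBundle X) (f : Hom E' E) (g : Hom E E''), IsShortExact f g →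
      φ E = φ E' + φ E'') : K0 X →+ A :=
  QuotientAddGroup.lift (AddSubgroup.closure (K0Rel X)) (FreeAbelianGroup.lift φ) (by
    rw [AddSubgroup.closure_le]
    rintro _ ⟨E', E, E'', f, g, hfg, rfl⟩
    simp [h _ _ _ f g hfg])

@[simp] theorem lift_cls {A : Type 1} [AddCommGroup A] (φ : AlgVectorBundle X → A) (h)
    (E : AlgVectorBundle X) : lift φ h (cls E) = φ E := by
  change QuotientAddGroup.lift _ _ _ (QuotientAddGroup.mk _) = _
  rw [QuotientAddGroup.lift_mk]
  simp

theorem hom_ext {A : Type 1} [AddCommGroup A] {φ ψ : K0 X →+ A} (h : ∀ E, φ (cls E) = ψ (cls E)) :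
    φ = ψ := by
  apply QuotientAddGroup.addMonoidHom_ext
  exact FreeAbelianGroup.lift_ext _ _ fun E => h E

theorem cls_zeroBundle : cls (zeroBundle X) = 0 := by
  have h := cls_exact (E' := zeroBundle X) (E := zeroBundle X) (E'' := zeroBundle X)
    ⟨fun _ => LinearMap.id, fun _ _ h => h⟩ ⟨fun _ => LinearMap.id, fun _ _ h => h⟩
    (fun x => ⟨fun _ _ h => h, fun y => ⟨fun _ => ⟨y, rfl⟩, fun _ => rfl⟩, fun y => ⟨y, rfl⟩⟩)
  simpa using h

theorem cls_eq_of_bijective {E F : AlgVectorBundle X} (f : Hom E F)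
    (h : ∀ x, Function.Bijective (f.toFun x)) : cls E = cls F := by
  have h := cls_exact (E' := E) (E := F) (E'' := zeroBundle X) f
    ⟨fun _ => 0, fun _ _ h => trivial⟩
    (fun x => ⟨(h x).1, fun y => ⟨fun _ => (h x).2 y, fun _ => rfl⟩, fun y => ⟨0, rfl⟩⟩)
  rw [h, cls_zeroBundle, add_zero]

end K0

namespace AlgVectorBundle

variable {X : Type} [SpaceWithFunctions X]

theorem _root_.GenReg.map {F : X → Type} [∀ x, AddCommGroup (F x)] [∀ x, Module ℂ (F x)]
    {gen : X → Set (∀ x, F x)} (G : AlgVectorBundle X) (φ : ∀ x, F x →ₗ[ℂ] G.fiber x) {x : X}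
    (h : ∀ s ∈ gen x, G.IsReg x fun y => φ y (s y)) {s : ∀ x, F x} (hs : GenReg gen x s) :
    G.IsReg x fun y => φ y (s y) := by
  induction hs with
  | of s hs => exact h s hs
  | zero =>
    simp only [Pi.zero_apply, map_zero]
    exact G.isReg_zero
  | add s t _ _ hs ht => simpa using hs.add ht
  | smul f s hf _ hs => simpa using hs.smul hf
  | congr s t hst _ hs => exact hs.congr (hst.mono fun y hy => by simp [hy])

/-- A morphism out of a tensor product, from a family of linear maps that sends tensor products of
regular sections to regular sections. -/
def tensorHom {E F : AlgVectorBundle X} (G : AlgVectorBundle X)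
    (φ : ∀ x, E.fiber x ⊗[ℂ] F.fiber x →ₗ[ℂ] G.fiber x)
    (h : ∀ x a b, E.IsReg x a → F.IsReg x b → G.IsReg x fun y => φ y (a y ⊗ₜ b y)) :
    Hom (tensor E F) G where
  toFun := φ
  map_reg x s hs := GenReg.map (gen := tensorGen E F) G φ (by
    rintro _ ⟨a, b, ha, hb, rfl⟩
    exact h x a b ha hb) hs

theorem isReg_tmul {E F : AlgVectorBundle X} {x : X} {a : ∀ x, E.fiber x} {b : ∀ x, F.fiber x}
    (ha : E.IsReg x a) (hb : F.IsReg x b) : (tensor E F).IsReg x fun y => a y ⊗ₜ[ℂ] b y :=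
  GenReg.of _ ⟨a, b, ha, hb, rfl⟩

theorem exact_tensor_left (E : AlgVectorBundle X) {F' F F'' : AlgVectorBundle X} (f : Hom F' F)
    (g : Hom F F'') (h : IsShortExact f g) :
    K0.cls (tensor E F) = K0.cls (tensor E F') + K0.cls (tensor E F'') := by
  refine K0.cls_exact
    (tensorHom (tensor E F) (fun x => (f.toFun x).lTensor (E.fiber x)) fun x _ b ha hb =>
      isReg_tmul ha (f.map_reg x b hb))
    (tensorHom (tensor E F'') (fun x => (g.toFun x).lTensor (E.fiber x)) fun x _ b ha hb =>
      isReg_tmul ha (g.map_reg x b hb)) fun x => ⟨?_, ?_, ?_⟩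
  · exact Module.Flat.lTensor_preserves_injective_linearMap _ (h x).1
  · exact lTensor_exact (E.fiber x) (h x).2.1 (h x).2.2
  · exact LinearMap.lTensor_surjective (E.fiber x) (h x).2.2

theorem cls_tensor_comm (E F : AlgVectorBundle X) :
    K0.cls (tensor E F) = K0.cls (tensor F E) :=
  K0.cls_eq_of_bijective (tensorHom (tensor F E)
    (fun x => (TensorProduct.comm ℂ (E.fiber x) (F.fiber x)).toLinearMap)
    fun _ _ _ ha hb => isReg_tmul hb ha) fun _ => (TensorProduct.comm ℂ _ _).bijective

theorem cls_tensor_assoc (E F G : AlgVectorBundle X) :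
    K0.cls (tensor (tensor E F) G) = K0.cls (tensor E (tensor F G)) := by
  refine K0.cls_eq_of_bijective (tensorHom (tensor E (tensor F G))
    (fun x => (TensorProduct.assoc ℂ (E.fiber x) (F.fiber x) (G.fiber x)).toLinearMap) ?_)
    fun x => (TensorProduct.assoc ℂ (E.fiber x) (F.fiber x) (G.fiber x)).bijective
  intro _ a c ha hc
  exact GenReg.map (gen := tensorGen E F) (tensor E (tensor F G))
    (fun y => (TensorProduct.assoc ℂ (E.fiber y) (F.fiber y) (G.fiber y)).toLinearMap ∘ₗ
      (TensorProduct.mk ℂ (E.fiber y ⊗[ℂ] F.fiber y) (G.fiber y)).flip (c y)) (by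
    rintro _ ⟨a, b, ha, hb, rfl⟩
    exact isReg_tmul ha (isReg_tmul hb hc)) ha

theorem cls_unit_tensor (E : AlgVectorBundle X) : K0.cls (tensor (unitBundle X) E) = K0.cls E :=
  K0.cls_eq_of_bijective (tensorHom E (fun x => (TensorProduct.lid ℂ (E.fiber x)).toLinearMap)
    fun _ _ _ ha hb => hb.smul ha) fun x => (TensorProduct.lid ℂ (E.fiber x)).bijective

end AlgVectorBundle

namespace K0

variable {X : Type} [SpaceWithFunctions X]

/-- The multiplication of `K0 X`: the biadditive map with `[E] · [F] = [E ⊗ F]`. -/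
def mulHom : K0 X →+ K0 X →+ K0 X :=
  lift (fun E => lift (fun F => cls (tensor E F)) fun _ _ _ f g h => exact_tensor_left E f g h)
    fun E' E E'' f g h => hom_ext fun F => by
      simp only [lift_cls, AddMonoidHom.add_apply]
      rw [cls_tensor_comm E, cls_tensor_comm E', cls_tensor_comm E'']
      exact exact_tensor_left F f g h

theorem mulHom_cls (E F : AlgVectorBundle X) : mulHom (cls E) (cls F) = cls (tensor E F) := by
  simp [mulHom]

theorem induction {p : K0 X → Prop} (hc : ∀ E, p (cls E)) (hn : ∀ a, p a → p (-a))
    (ha : ∀ a b, p a → p b → p (a + b)) (a : K0 X) : p a := by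
  obtain ⟨r, rfl⟩ := QuotientAddGroup.mk_surjective a
  induction r using FreeAbelianGroup.induction_on with
  | zero =>
    have := ha _ _ (hc (zeroBundle X)) (hn _ (hc (zeroBundle X)))
    rw [add_neg_cancel] at this
    exact this
  | of E => exact hc E
  | neg E h => exact hn _ h
  | add r s hr hs => exact ha _ _ hr hs

instance : CommRing (K0 X) :=
  { (inferInstance : AddCommGroup (K0 X)) with
    mul := fun a b => mulHom a b
    one := cls (unitBundle X)
    left_distrib := fun a b c => map_add (mulHom a) b c
    right_distrib := fun a b c => by
      change mulHom (a + b) c = mulHom a c + mulHom b c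
      simp
    zero_mul := fun a => by
      change mulHom 0 a = 0
      simp
    mul_zero := fun a => map_zero (mulHom a)
    mul_assoc := fun a b c => by
      change mulHom (mulHom a b) c = mulHom a (mulHom b c)
      induction a using induction with
      | hn a h => simp [h]
      | ha a a' h h' => simp [h, h']
      | hc E =>
        induction b using induction with
        | hn a h => simp [h]
        | ha a a' h h' => simp [h, h']
        | hc F =>
          induction c using induction with
          | hn a h => simp [h]
          | ha a a' h h' => simp [h, h']
          | hc G => simp only [mulHom_cls, cls_tensor_assoc]
    one_mul := fun a => by
      change mulHom (cls (unitBundle X)) a = a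
      induction a using induction with
      | hn a h => simp [h]
      | ha a a' h h' => simp [h, h']
      | hc E => rw [mulHom_cls, cls_unit_tensor]
    mul_one := fun a => by
      change mulHom a (cls (unitBundle X)) = a
      induction a using induction with
      | hn a h => simp [h]
      | ha a a' h h' => simp [h, h']
      | hc E => rw [mulHom_cls, cls_tensor_comm, cls_unit_tensor]
    mul_comm := fun a b => by
      change mulHom a b = mulHom b a
      induction a using induction with
      | hn a h => simp [h]
      | ha a a' h h' => simp [h, h']
      | hc E =>
        induction b using induction with
        | hn a h => simp [h]
        | ha a a' h h' => simp [h, h']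
        | hc F => rw [mulHom_cls, mulHom_cls, cls_tensor_comm] }

theorem cls_mul_cls (E F : AlgVectorBundle X) : cls E * cls F = cls (tensor E F) :=
  mulHom_cls E F

end K0

/-! ### The Grassmannian `G(2,4)` -/

/-- The Grassmannian `G(2,4)`: the set of two-dimensional subspaces of `ℂ⁴`, that is, of lines in
projective three-space. -/
structure Gr24 : Type where
  plane : Submodule ℂ (Fin 4 → ℂ)
  finrank_eq : Module.finrank ℂ plane = 2

namespace Gr24

/-- A chosen basis of the subspace `l`. -/
def basis (l : Gr24) : Module.Basis (Fin 2) ℂ l.plane := Module.finBasisOfFinrankEq ℂ l.plane l.finrank_eq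

/-- The Plücker coordinates `p_{ij} = u_i v_j - u_j v_i` of `l`, for the chosen basis `u, v` of `l`
(another basis multiplies all of them by one nonzero number). All pairs `(i, j)` are used, so that
the coordinates are redundant. -/
def plucker (l : Gr24) (p : Fin 4 × Fin 4) : ℂ :=
  (l.basis 0 : Fin 4 → ℂ) p.1 * (l.basis 1 : Fin 4 → ℂ) p.2 -
    (l.basis 0 : Fin 4 → ℂ) p.2 * (l.basis 1 : Fin 4 → ℂ) p.1

/-- The value at `l` of a polynomial in the Plücker coordinates. -/
abbrev ev (P : MvPolynomial (Fin 4 × Fin 4) ℂ) (l : Gr24) : ℂ := MvPolynomial.eval l.plucker P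

/-- The Zariski topology, which is generated by the non-vanishing loci of homogeneous polynomials in
the Plücker coordinates. -/
instance : TopologicalSpace Gr24 := TopologicalSpace.generateFrom
  {U | ∃ (n : ℕ) (Q : MvPolynomial (Fin 4 × Fin 4) ℂ), Q.IsHomogeneous n ∧ U = {l | ev Q l ≠ 0}}

theorem isBasis : TopologicalSpace.IsTopologicalBasis
    {U : Set Gr24 | ∃ (n : ℕ) (Q : MvPolynomial (Fin 4 × Fin 4) ℂ),
      Q.IsHomogeneous n ∧ U = {l | ev Q l ≠ 0}} where
  exists_subset_inter := by
    rintro _ ⟨n, Q, hQ, rfl⟩ _ ⟨m, R, hR, rfl⟩ l ⟨h1, h2⟩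
    exact ⟨_, ⟨n + m, Q * R, hQ.mul hR, rfl⟩, by simpa using ⟨h1, h2⟩, fun x hx => by
      simpa [not_or] using hx⟩
  sUnion_eq := Set.eq_univ_of_forall fun l =>
    ⟨_, ⟨0, 1, MvPolynomial.isHomogeneous_one _ _, rfl⟩, by simp⟩
  eq_generateFrom := rfl

theorem eventually_ne {n : ℕ} {Q : MvPolynomial (Fin 4 × Fin 4) ℂ} (hQ : Q.IsHomogeneous n)
    {l : Gr24} (h : ev Q l ≠ 0) : ∀ᶠ m in 𝓝 l, ev Q m ≠ 0 :=
  (isBasis.isOpen ⟨n, Q, hQ, rfl⟩).mem_nhds h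

theorem exists_of_eventually {p : Gr24 → Prop} {l : Gr24} (h : ∀ᶠ m in 𝓝 l, p m) :
    ∃ (n : ℕ) (Q : MvPolynomial (Fin 4 × Fin 4) ℂ), Q.IsHomogeneous n ∧ ev Q l ≠ 0 ∧
      ∀ m, ev Q m ≠ 0 → p m := by
  obtain ⟨_, ⟨n, Q, hQ, rfl⟩, h1, h2⟩ := isBasis.mem_nhds_iff.1 h
  exact ⟨n, Q, hQ, h1, fun m hm => h2 hm⟩

/-- The regular functions: `f` is regular at `l` if, near `l`, it is a quotient of two homogeneous
polynomials of the same degree in the Plücker coordinates. -/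
def IsRegular (l : Gr24) (f : Gr24 → ℂ) : Prop :=
  ∃ (n : ℕ) (P Q : MvPolynomial (Fin 4 × Fin 4) ℂ), P.IsHomogeneous n ∧ Q.IsHomogeneous n ∧
    ev Q l ≠ 0 ∧ ∀ᶠ m in 𝓝 l, f m = ev P m / ev Q m

/-- The Grassmannian as a space with functions. -/
instance : SpaceWithFunctions Gr24 where
  regAt l :=
    { carrier := {f | IsRegular l f}
      algebraMap_mem' := fun c => ⟨0, MvPolynomial.C c, 1, MvPolynomial.isHomogeneous_C _ _,
        MvPolynomial.isHomogeneous_one _ _, by simp, by simp⟩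
      mul_mem' := by
        rintro f g ⟨n, P, Q, hP, hQ, h0, h⟩ ⟨n', P', Q', hP', hQ', h0', h'⟩
        refine ⟨n + n', P * P', Q * Q', hP.mul hP', hQ.mul hQ', by simp [h0, h0'], ?_⟩
        filter_upwards [h, h'] with m hm hm'
        simp [hm, hm', div_mul_div_comm]
      add_mem' := by
        rintro f g ⟨n, P, Q, hP, hQ, h0, h⟩ ⟨n', P', Q', hP', hQ', h0', h'⟩
        refine ⟨n + n', P * Q' + Q * P', Q * Q', (hP.mul hQ').add (hQ.mul hP'), hQ.mul hQ',
          by simp [h0, h0'], ?_⟩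
        filter_upwards [h, h', eventually_ne hQ h0, eventually_ne hQ' h0'] with m hm hm' h1 h2
        simp [hm, hm', div_add_div _ _ h1 h2] }
  regAt_congr := by
    rintro l f g hfg ⟨n, P, Q, hP, hQ, h0, h⟩
    refine ⟨n, P, Q, hP, hQ, h0, ?_⟩
    filter_upwards [hfg, h] with m h1 h2
    rw [← h1, h2]
  regAt_eventually := by
    rintro l f ⟨n, P, Q, hP, hQ, h0, h⟩
    filter_upwards [eventually_ne hQ h0, eventually_eventually_nhds.2 h] with m h1 h2
    exact ⟨n, P, Q, hP, hQ, h1, h2⟩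
  eventually_ne_zero := by
    rintro l f ⟨n, P, Q, hP, hQ, h0, h⟩ hf
    have h1 : ev P l ≠ 0 := by
      intro h1
      exact hf (by rw [h.self_of_nhds, h1, zero_div])
    filter_upwards [eventually_ne hQ h0, eventually_ne hP h1, h] with m h2 h3 h4
    rw [h4]
    exact div_ne_zero h3 h2
  regAt_inv := by
    rintro l f ⟨n, P, Q, hP, hQ, h0, h⟩ hf
    have h1 : ev P l ≠ 0 := by
      intro h1
      exact hf (by rw [h.self_of_nhds, h1, zero_div])
    refine ⟨n, Q, P, hQ, hP, h1, ?_⟩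
    filter_upwards [h] with m hm
    rw [Pi.inv_apply, hm, inv_div]

/-! Near a point where `p_{ij} ≠ 0`, the linear forms `x_a + c_a x_i + c'_a x_j` below, with
`a ≠ i, j`, form a basis of the linear forms that vanish on `l`. -/

/-- The coefficients of the linear forms that cut out `l`. -/
def cf (i j a : Fin 4) (l : Gr24) : ℂ := if a = i ∨ a = j then 0 else
  l.plucker (j, a) / l.plucker (i, j)

/-- The coefficients of the linear forms that cut out `l`. -/
def cf' (i j a : Fin 4) (l : Gr24) : ℂ := if a = i ∨ a = j then 0 else
  - (l.plucker (i, a) / l.plucker (i, j))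

theorem regular_quot {l : Gr24} {p q : Fin 4 × Fin 4} (h : l.plucker q ≠ 0) :
    (fun m : Gr24 => m.plucker p / m.plucker q) ∈ SpaceWithFunctions.regAt l :=
  ⟨1, MvPolynomial.X p, MvPolynomial.X q, MvPolynomial.isHomogeneous_X _ _,
    MvPolynomial.isHomogeneous_X _ _, by simpa using h, by simp⟩

theorem const_regular (l : Gr24) (c : ℂ) : (fun _ : Gr24 => c) ∈ SpaceWithFunctions.regAt l :=
  (SpaceWithFunctions.regAt l).algebraMap_mem c

theorem cf_regular {l : Gr24} {i j : Fin 4} (h : l.plucker (i, j) ≠ 0) (a : Fin 4) :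
    cf i j a ∈ SpaceWithFunctions.regAt l := by
  by_cases ha : a = i ∨ a = j
  · have : cf i j a = 0 := by funext m; simp [cf, ha]
    rw [this]; exact zero_mem _
  · have : cf i j a = fun m => m.plucker (j, a) / m.plucker (i, j) := by funext m; simp [cf, ha]
    rw [this]; exact regular_quot h

theorem cf'_regular {l : Gr24} {i j : Fin 4} (h : l.plucker (i, j) ≠ 0) (a : Fin 4) :
    cf' i j a ∈ SpaceWithFunctions.regAt l := by
  by_cases ha : a = i ∨ a = j
  · have : cf' i j a = 0 := by funext m; simp [cf', ha]
    rw [this]; exact zero_mem _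
  · have : cf' i j a = -fun m => m.plucker (i, a) / m.plucker (i, j) := by
      funext m; simp [cf', ha]
    rw [this]; exact neg_mem (regular_quot h)

theorem mem_iff (l : Gr24) (v : Fin 4 → ℂ) : v ∈ l.1 ↔
    ∃ a b : ℂ, v = a • (l.basis 0 : Fin 4 → ℂ) + b • (l.basis 1 : Fin 4 → ℂ) := by
  constructor
  · intro hv
    have h := l.basis.sum_repr ⟨v, hv⟩
    rw [Fin.sum_univ_two] at h
    exact ⟨_, _, (congrArg Subtype.val h).symm⟩
  · rintro ⟨a, b, rfl⟩
    exact add_mem (Submodule.smul_mem _ _ (l.basis 0).2) (Submodule.smul_mem _ _ (l.basis 1).2)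

theorem exists_plucker_ne (l : Gr24) : ∃ i j, l.plucker (i, j) ≠ 0 := by
  by_contra! h
  have hli : LinearIndependent ℂ (fun k => (l.basis k : Fin 4 → ℂ)) :=
    l.basis.linearIndependent.map' l.1.subtype (Submodule.ker_subtype _)
  have h0 : (l.basis 0 : Fin 4 → ℂ) ≠ 0 := hli.ne_zero 0
  obtain ⟨i, hi⟩ := Function.ne_iff.1 h0
  rw [Fintype.linearIndependent_iff] at hli
  have := hli ![(l.basis 1 : Fin 4 → ℂ) i, -(l.basis 0 : Fin 4 → ℂ) i] (by
    rw [Fin.sum_univ_two]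
    funext j
    have := h i j
    simp only [plucker] at this
    simp
    linear_combination -this) 1
  exact hi (by simpa using this)

theorem eventually_plucker_ne {l : Gr24} {p : Fin 4 × Fin 4} (h : l.plucker p ≠ 0) :
    ∀ᶠ m : Gr24 in 𝓝 l, m.plucker p ≠ 0 := by
  have := eventually_ne (l := l) (MvPolynomial.isHomogeneous_X ℂ p) (by simpa using h)
  simpa using this

theorem plucker_ne_idx {l : Gr24} {i j : Fin 4} (h : l.plucker (i, j) ≠ 0) : i ≠ j := by
  rintro rfl
  simp [plucker] at h

/-- The linear forms vanish on `l`. -/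
theorem vanish {l : Gr24} {i j a : Fin 4} (h : l.plucker (i, j) ≠ 0) (ha : a ≠ i ∧ a ≠ j)
    {v : Fin 4 → ℂ} (hv : v ∈ l.1) : v a + cf i j a l * v i + cf' i j a l * v j = 0 := by
  obtain ⟨s, t, rfl⟩ := (mem_iff l v).1 hv
  simp only [cf, cf', ha.1, ha.2, or_self, if_false]
  field_simp
  simp [plucker]
  ring

/-- The coordinates `v i`, `v j` can be prescribed on `l`. -/
theorem exists_mem {l : Gr24} {i j : Fin 4} (h : l.plucker (i, j) ≠ 0) (s t : ℂ) :
    ∃ v ∈ l.1, v i = s ∧ v j = t := by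
  set u : Fin 4 → ℂ := (l.basis 0 : Fin 4 → ℂ) with hu
  set w : Fin 4 → ℂ := (l.basis 1 : Fin 4 → ℂ) with hw
  have hp : l.plucker (i, j) = u i * w j - u j * w i := rfl
  rw [hp] at h
  refine ⟨((s * w j - t * w i) / (u i * w j - u j * w i)) • u +
    ((t * u i - s * u j) / (u i * w j - u j * w i)) • w, (mem_iff l _).2 ⟨_, _, rfl⟩, ?_, ?_⟩
  · simp only [Pi.add_apply, Pi.smul_apply, smul_eq_mul]
    rw [div_mul_eq_mul_div, div_mul_eq_mul_div, ← add_div, div_eq_iff h]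
    ring
  · simp only [Pi.add_apply, Pi.smul_apply, smul_eq_mul]
    rw [div_mul_eq_mul_div, div_mul_eq_mul_div, ← add_div, div_eq_iff h]
    ring

/-- The index set of the linear forms. -/
abbrev Idx (i j : Fin 4) : Type := {a : Fin 4 // a ≠ i ∧ a ≠ j}

/-- The linear forms that cut out `l`, as functionals. -/
def form (i j a : Fin 4) (l : Gr24) : Module.Dual ℂ (Fin 4 → ℂ) :=
  LinearMap.proj a + cf i j a l • LinearMap.proj i + cf' i j a l • LinearMap.proj j

theorem eq_sum_form {l : Gr24} {i j : Fin 4} (h : l.plucker (i, j) ≠ 0)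
    {φ : Module.Dual ℂ (Fin 4 → ℂ)} (hφ : φ ∈ l.1.dualAnnihilator) :
    φ = ∑ a : Idx i j, φ (Pi.single a.1 1) • form i j a.1 l := by
  apply LinearMap.ext
  intro v
  obtain ⟨v', hv', hi, hj⟩ := exists_mem h (v i) (v j)
  have h1 : φ v = φ (v - v') := by
    rw [map_sub, (Submodule.mem_dualAnnihilator φ).1 hφ v' hv', sub_zero]
  rw [h1, LinearMap.pi_apply_eq_sum_univ φ, LinearMap.sum_apply]
  rw [← Finset.sum_filter_of_ne (p := fun a => a ≠ i ∧ a ≠ j),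
    Finset.sum_subtype (p := fun a => a ≠ i ∧ a ≠ j) _ (by simp)]
  · refine Finset.sum_congr rfl fun a _ => ?_
    have h2 := vanish h a.2 hv'
    rw [hi, hj] at h2
    have h3 : form i j a.1 l v = v a.1 - v' a.1 := by
      simp only [form, LinearMap.add_apply, LinearMap.smul_apply, LinearMap.proj_apply,
        smul_eq_mul]
      linear_combination h2
    rw [LinearMap.smul_apply, h3, smul_eq_mul, smul_eq_mul, mul_comm]
    congr 2
    ext b
    simp [Pi.single_apply, eq_comm]
  · intro a _ ha
    constructor
    · rintro rfl
      simp [hi] at ha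
    · rintro rfl
      simp [hj] at ha

theorem form_single {i j a b : Fin 4} (hb : b ≠ i ∧ b ≠ j) (l : Gr24) :
    form i j a l (Pi.single b 1) = if a = b then 1 else 0 := by
  simp [form, Pi.single_apply, hb.1.symm, hb.2.symm]

/-- The bundle `ν` of linear forms on `ℂ⁴` that vanish on `l`, dual to the quotient bundle: a
subbundle of the trivial bundle with fibre the dual of `ℂ⁴`. -/
def nu : AlgVectorBundle Gr24 where
  fiber l := l.1.dualAnnihilator
  IsReg l s := ∀ v : Fin 4 → ℂ, (fun m => (s m).1 v) ∈ SpaceWithFunctions.regAt l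
  exists_frame l := by
    classical
    obtain ⟨i, j, h⟩ := exists_plucker_ne l
    refine ⟨Idx i j, inferInstance, fun a m => if hm : m.plucker (i, j) ≠ 0 then
      ⟨form i j a.1 m, (Submodule.mem_dualAnnihilator _).2 fun v hv => by
        simpa [form] using vanish hm a.2 hv⟩ else 0, ?_⟩
    filter_upwards [eventually_plucker_ne h] with y hy
    have he : ∀ m : Gr24, m.plucker (i, j) ≠ 0 → ∀ a : Idx i j,
        ((if hm : m.plucker (i, j) ≠ 0 then ⟨form i j a.1 m, (Submodule.mem_dualAnnihilator _).2
          fun v hv => by simpa [form] using vanish hm a.2 hv⟩ else 0 : m.1.dualAnnihilator) :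
          Module.Dual ℂ (Fin 4 → ℂ)) = form i j a.1 m := by
      intro m hm a
      rw [dif_pos hm]
    refine ⟨?_, ?_, fun s => ⟨fun hs => ?_, ?_⟩⟩
    · rw [Fintype.linearIndependent_iff]
      intro g hg b
      have h1 := congrArg (fun φ : y.1.dualAnnihilator =>
        (φ : Module.Dual ℂ (Fin 4 → ℂ)) (Pi.single b.1 1)) hg
      simp only [Submodule.coe_sum, Submodule.coe_smul, LinearMap.sum_apply, LinearMap.smul_apply,
        he y hy, form_single b.2] at h1
      simpa [← Subtype.ext_iff] using h1
    · rintro ⟨φ, hφ⟩ -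
      refine (Submodule.mem_span_range_iff_exists_fun ℂ).2
        ⟨fun a => φ (Pi.single a.1 1), Subtype.ext ?_⟩
      simp only [Submodule.coe_sum, Submodule.coe_smul, he y hy]
      exact (eq_sum_form hy hφ).symm
    · refine ⟨fun a m => (s m).1 (Pi.single a.1 1), fun a => hs _, ?_⟩
      filter_upwards [eventually_plucker_ne hy] with m hm
      apply Subtype.ext
      simp only [Submodule.coe_sum, Submodule.coe_smul, he m hm]
      exact eq_sum_form hm (s m).2
    · rintro ⟨c, hc, hs⟩ v
      have h1 : (∑ a : Idx i j, c a * ((fun _ => v a.1) + cf i j a.1 * (fun _ => v i) +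
          cf' i j a.1 * fun _ => v j)) ∈ SpaceWithFunctions.regAt y :=
        sum_mem fun a _ => mul_mem (hc a) (add_mem (add_mem (const_regular _ _)
          (mul_mem (cf_regular hy _) (const_regular _ _)))
          (mul_mem (cf'_regular hy _) (const_regular _ _)))
      refine SpaceWithFunctions.regAt_congr ?_ h1
      filter_upwards [hs, eventually_plucker_ne hy] with m hm1 hm2
      rw [hm1]
      simp only [Submodule.coe_sum, Submodule.coe_smul, he m hm2, Finset.sum_apply]
      simp [form]
      exact Finset.sum_congr rfl fun a _ => by ring

/-- The homogeneous polynomials of degree `d` on `ℂ⁴` that vanish on `l` to order `k`, that is,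
that lie in the `k`-th power of the ideal of `l`. -/
def vanishingPolys (k d : ℕ) (l : Gr24) : Submodule ℂ (MvPolynomial (Fin 4) ℂ) :=
  MvPolynomial.homogeneousSubmodule (Fin 4) ℂ d ⊓
    (MvPolynomial.vanishingIdeal ℂ (l.1 : Set (Fin 4 → ℂ)) ^ k).restrictScalars ℂ

/-- The substitution `x_a ↦ x_a + c_a x_i + c'_a x_j`. -/
def sub {R : Type} [CommRing R] (i j : Fin 4) (c c' : Fin 4 → R) :
    MvPolynomial (Fin 4) R →ₐ[R] MvPolynomial (Fin 4) R :=
  MvPolynomial.aeval fun a =>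
    MvPolynomial.X a + MvPolynomial.C (c a) * MvPolynomial.X i +
      MvPolynomial.C (c' a) * MvPolynomial.X j

theorem sub_X {R : Type} [CommRing R] (i j a : Fin 4) (c c' : Fin 4 → R) :
    sub i j c c' (MvPolynomial.X a) = MvPolynomial.X a + MvPolynomial.C (c a) * MvPolynomial.X i +
      MvPolynomial.C (c' a) * MvPolynomial.X j := by
  simp [sub]

theorem sub_neg_sub {R : Type} [CommRing R] {i j : Fin 4} {c c' : Fin 4 → R} (h1 : c i = 0)
    (h2 : c j = 0) (h3 : c' i = 0) (h4 : c' j = 0) (p : MvPolynomial (Fin 4) R) :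
    sub i j c c' (sub i j (-c) (-c') p) = p := by
  have : (sub i j c c').comp (sub i j (-c) (-c')) = AlgHom.id R _ := by
    apply MvPolynomial.algHom_ext
    intro a
    rw [AlgHom.comp_apply, sub_X, map_add, map_add, map_mul, map_mul, sub_X, sub_X, sub_X,
      h1, h2, h3, h4]
    simp only [MvPolynomial.algHom_C, MvPolynomial.algebraMap_eq, AlgHom.id_apply, Pi.neg_apply,
      map_neg, map_zero]
    ring
  exact congrArg (fun f => f p) this

theorem sub_homogeneous {R : Type} [CommRing R] {i j : Fin 4} {c c' : Fin 4 → R} {d : ℕ}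
    {p : MvPolynomial (Fin 4) R} (hp : p.IsHomogeneous d) : (sub i j c c' p).IsHomogeneous d := by
  have h := hp.aeval (fun a => MvPolynomial.X a + MvPolynomial.C (c a) * MvPolynomial.X i +
      MvPolynomial.C (c' a) * MvPolynomial.X j) (n := 1) fun a =>
    ((MvPolynomial.isHomogeneous_X _ _).add (MvPolynomial.isHomogeneous_C_mul_X _ _)).add
      (MvPolynomial.isHomogeneous_C_mul_X _ _)
  rwa [one_mul] at h

/-- The coefficients of a substituted polynomial are regular functions. -/
theorem coeff_sub_regular {l : Gr24} (i j : Fin 4) {c c' : Fin 4 → Gr24 → ℂ}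
    (hc : ∀ a, c a ∈ SpaceWithFunctions.regAt l) (hc' : ∀ a, c' a ∈ SpaceWithFunctions.regAt l)
    (J K : Fin 4 →₀ ℕ) :
    (fun m => (sub i j (fun a => c a m) (fun a => c' a m) (MvPolynomial.monomial J 1)).coeff K) ∈
      SpaceWithFunctions.regAt l := by
  let P := sub (R := SpaceWithFunctions.regAt l) i j (fun a => ⟨c a, hc a⟩)
    (fun a => ⟨c' a, hc' a⟩) (MvPolynomial.monomial J 1)
  have h : (fun m => (sub i j (fun a => c a m) (fun a => c' a m)
      (MvPolynomial.monomial J 1)).coeff K) = (P.coeff K).1 := by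
    funext m
    let ev : SpaceWithFunctions.regAt l →+* ℂ :=
      (Pi.evalRingHom (fun _ : Gr24 => ℂ) m).comp (SpaceWithFunctions.regAt l).val.toRingHom
    have h1 : P.map ev = sub i j (fun a => c a m) (fun a => c' a m)
        (MvPolynomial.monomial J 1) := by
      simp only [P, sub, MvPolynomial.aeval_monomial, map_one, one_mul, Finsupp.prod, map_prod,
        map_pow, map_add, map_mul, MvPolynomial.map_X, MvPolynomial.map_C]
      rfl
    rw [← h1, MvPolynomial.coeff_map]
    rfl
  rw [h]
  exact (P.coeff K).2

/-- The substitution that straightens `l`. -/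
abbrev sg (i j : Fin 4) (l : Gr24) : MvPolynomial (Fin 4) ℂ →ₐ[ℂ] MvPolynomial (Fin 4) ℂ :=
  sub i j (fun a => cf i j a l) fun a => cf' i j a l

/-- The inverse substitution. -/
abbrev tu (i j : Fin 4) (l : Gr24) : MvPolynomial (Fin 4) ℂ →ₐ[ℂ] MvPolynomial (Fin 4) ℂ :=
  sub i j (fun a => (-cf i j a) l) fun a => (-cf' i j a) l

theorem sg_tu (i j : Fin 4) (l : Gr24) (p : MvPolynomial (Fin 4) ℂ) :
    sg i j l (tu i j l p) = p :=
  sub_neg_sub (c := fun a => cf i j a l) (c' := fun a => cf' i j a l) (by simp [cf]) (by simp [cf])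
    (by simp [cf']) (by simp [cf']) p

theorem tu_sg (i j : Fin 4) (l : Gr24) (p : MvPolynomial (Fin 4) ℂ) :
    tu i j l (sg i j l p) = p := by
  have h := sub_neg_sub (i := i) (j := j) (c := fun a => -cf i j a l) (c' := fun a => -cf' i j a l)
    (by simp [cf]) (by simp [cf]) (by simp [cf']) (by simp [cf']) p
  have h1 : ∀ c : Fin 4 → ℂ, -(fun a => -c a) = c := fun c => by funext a; simp
  rw [h1 fun a => cf i j a l, h1 fun a => cf' i j a l] at h
  exact h

/-- The ideal of the coordinate line in direction `i, j`. -/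
abbrev stdIdeal (i j : Fin 4) : Ideal (MvPolynomial (Fin 4) ℂ) :=
  Ideal.span (MvPolynomial.X '' {a | a ≠ i ∧ a ≠ j})

theorem mem_stdIdeal (i j : Fin 4) (q : MvPolynomial (Fin 4) ℂ) : q ∈ stdIdeal i j ↔
    ∀ w : Fin 4 → ℂ, (∀ a, a ≠ i ∧ a ≠ j → w a = 0) → MvPolynomial.eval w q = 0 := by
  classical
  constructor
  · intro hq w hw
    have h : stdIdeal i j ≤ RingHom.ker (MvPolynomial.eval w) := by
      rw [Ideal.span_le]
      rintro _ ⟨a, ha, rfl⟩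
      simpa using hw a ha
    exact h hq
  · intro h
    let ρ : MvPolynomial (Fin 4) ℂ →ₐ[ℂ] MvPolynomial (Fin 4) ℂ := MvPolynomial.aeval fun a =>
      if a ≠ i ∧ a ≠ j then 0 else MvPolynomial.X a
    have h0 : ρ q = 0 := by
      apply MvPolynomial.funext
      intro w
      rw [map_zero]
      have h1 : MvPolynomial.eval w (ρ q) =
          MvPolynomial.eval (fun a => if a ≠ i ∧ a ≠ j then 0 else w a) q := by
        have : (MvPolynomial.aeval w).comp ρ = MvPolynomial.aeval (R := ℂ)
            (fun a => if a ≠ i ∧ a ≠ j then (0 : ℂ) else w a) := by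
          apply MvPolynomial.algHom_ext
          intro a
          simp only [ρ, AlgHom.comp_apply, MvPolynomial.aeval_X]
          split_ifs <;> simp
        exact congrArg (fun f => f q) this
      rw [h1]
      exact h (fun a => if a ≠ i ∧ a ≠ j then 0 else w a) fun a ha => if_pos ha
    have h2 : (Ideal.Quotient.mkₐ ℂ (stdIdeal i j)).comp ρ = Ideal.Quotient.mkₐ ℂ (stdIdeal i j) := by
      apply MvPolynomial.algHom_ext
      intro a
      simp only [ρ, AlgHom.comp_apply, MvPolynomial.aeval_X]
      split_ifs with ha
      · rw [map_zero]
        have hX : (MvPolynomial.X a : MvPolynomial (Fin 4) ℂ) ∈ stdIdeal i j :=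
          Ideal.subset_span ⟨a, ha, rfl⟩
        exact (Ideal.Quotient.eq_zero_iff_mem.2 hX).symm
      · rfl
    have h3 := congrArg (fun f => f q) h2
    simp only [AlgHom.comp_apply, h0, map_zero] at h3
    exact Ideal.Quotient.eq_zero_iff_mem.1 h3.symm

theorem eval_sg (i j : Fin 4) (l : Gr24) (v : Fin 4 → ℂ) (q : MvPolynomial (Fin 4) ℂ) :
    MvPolynomial.eval v (sg i j l q) =
      MvPolynomial.eval (fun a => v a + cf i j a l * v i + cf' i j a l * v j) q := by
  have : (MvPolynomial.aeval v).comp (sg i j l) = MvPolynomial.aeval (R := ℂ)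
      (fun a => v a + cf i j a l * v i + cf' i j a l * v j) := by
    apply MvPolynomial.algHom_ext
    intro a
    rw [AlgHom.comp_apply, sub_X]
    simp
  exact congrArg (fun f => f q) this

theorem vanishingIdeal_eq {l : Gr24} {i j : Fin 4} (h : l.plucker (i, j) ≠ 0) :
    MvPolynomial.vanishingIdeal ℂ (l.1 : Set (Fin 4 → ℂ)) =
      (stdIdeal i j).map (sg i j l) := by
  have key : ∀ q, q ∈ stdIdeal i j ↔
      sg i j l q ∈ MvPolynomial.vanishingIdeal ℂ (l.1 : Set (Fin 4 → ℂ)) := by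
    intro q
    rw [mem_stdIdeal, MvPolynomial.mem_vanishingIdeal_iff]
    constructor
    · intro hq v hv
      change MvPolynomial.eval v (sg i j l q) = 0
      rw [eval_sg]
      exact hq _ fun a ha => vanish h ha hv
    · intro hq w hw
      obtain ⟨v, hv, hi, hj⟩ := exists_mem h (w i) (w j)
      have h1 : MvPolynomial.eval v (sg i j l q) = 0 := hq v hv
      rw [eval_sg] at h1
      refine Eq.trans ?_ h1
      refine congrArg (fun u => MvPolynomial.eval u q) ?_
      funext a
      by_cases ha : a ≠ i ∧ a ≠ j
      · rw [hw a ha, vanish h ha hv]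
      · have ha' : a = i ∨ a = j := by tauto
        simp only [cf, cf', ha', if_true, zero_mul, add_zero]
        rcases ha' with rfl | rfl
        exacts [hi.symm, hj.symm]
  ext p
  rw [Ideal.mem_map_iff_of_surjective _ fun p => ⟨_, sg_tu i j l p⟩]
  constructor
  · intro hp
    exact ⟨tu i j l p, (key _).2 (by rwa [sg_tu]), sg_tu i j l p⟩
  · rintro ⟨q, hq, rfl⟩
    exact (key q).1 hq

/-- The degree of a monomial in the variables that vanish on the coordinate line. -/
abbrev wt (i j : Fin 4) (J : Fin 4 →₀ ℕ) : ℕ := ∑ a : Idx i j, J a.1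

theorem stdIdeal_pow_wt (i j : Fin 4) (k : ℕ) : ∀ q ∈ stdIdeal i j ^ k, ∀ J,
    q.coeff J ≠ 0 → k ≤ wt i j J := by
  classical
  have hmul : ∀ (n n' : ℕ) (q r : MvPolynomial (Fin 4) ℂ), (∀ J, q.coeff J ≠ 0 → n ≤ wt i j J) →
      (∀ J, r.coeff J ≠ 0 → n' ≤ wt i j J) → ∀ J, (q * r).coeff J ≠ 0 → n + n' ≤ wt i j J := by
    intro n n' q r hq hr J hJ
    rw [MvPolynomial.coeff_mul] at hJ
    obtain ⟨⟨J1, J2⟩, h1, h2⟩ := Finset.exists_ne_zero_of_sum_ne_zero hJ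
    rw [Finset.HasAntidiagonal.mem_antidiagonal] at h1
    have h3 := hq J1 (left_ne_zero_of_mul h2)
    have h4 := hr J2 (right_ne_zero_of_mul h2)
    have h5 : wt i j J = wt i j J1 + wt i j J2 := by
      simp [wt, ← h1, Finset.sum_add_distrib]
    omega
  have hadd : ∀ (n : ℕ) (q r : MvPolynomial (Fin 4) ℂ), (∀ J, q.coeff J ≠ 0 → n ≤ wt i j J) →
      (∀ J, r.coeff J ≠ 0 → n ≤ wt i j J) → ∀ J, (q + r).coeff J ≠ 0 → n ≤ wt i j J := by
    intro n q r hq hr J hJ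
    rw [MvPolynomial.coeff_add] at hJ
    by_cases h : q.coeff J = 0
    · exact hr J fun h' => hJ (by rw [h, h', add_zero])
    · exact hq J h
  induction k with
  | zero => intros; exact Nat.zero_le _
  | succ k ih =>
    intro q hq
    rw [pow_succ] at hq
    refine Submodule.mul_induction_on hq (fun r hr t ht => hmul k 1 r t (ih r hr) ?_) (hadd _)
    intro J hJ
    obtain ⟨a, ha, h⟩ := MvPolynomial.mem_ideal_span_X_image.1 ht J
      (MvPolynomial.mem_support_iff.2 hJ)
    have := Finset.single_le_sum (f := fun a : Idx i j => J a.1) (fun _ _ => Nat.zero_le _)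
      (Finset.mem_univ ⟨a, ha⟩)
    have h' : J a ≠ 0 := h
    simp only [wt] at this ⊢
    omega

theorem monomial_mem {i j : Fin 4} {k : ℕ} {J : Fin 4 →₀ ℕ} (hJ : k ≤ wt i j J) :
    MvPolynomial.monomial J (1 : ℂ) ∈ stdIdeal i j ^ k := by
  classical
  refine Ideal.pow_le_pow_right hJ ?_
  have h0 : MvPolynomial.monomial J (1 : ℂ) = ∏ a, MvPolynomial.X a ^ J a := by
    rw [MvPolynomial.monomial_eq, Finsupp.prod_fintype _ _ (by simp), map_one, one_mul]
  rw [h0, ← Finset.prod_filter_mul_prod_filter_not Finset.univ (fun a => a ≠ i ∧ a ≠ j)]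
  refine Ideal.mul_mem_right _ _ ?_
  rw [Finset.prod_subtype (p := fun a => a ≠ i ∧ a ≠ j) _ (by simp), ← Finset.prod_pow_eq_pow_sum]
  have hX : ∀ a : Idx i j, (MvPolynomial.X a.1 : MvPolynomial (Fin 4) ℂ) ^ J a.1 ∈
      stdIdeal i j ^ J a.1 := by
    intro a
    have h1 : (MvPolynomial.X a.1 : MvPolynomial (Fin 4) ℂ) ∈ stdIdeal i j :=
      Ideal.subset_span ⟨a.1, a.2, rfl⟩
    exact Ideal.pow_mem_pow h1 _
  exact Ideal.prod_mem_prod (s := Finset.univ) (I := fun a : Idx i j => stdIdeal i j ^ J a.1)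
    (x := fun a : Idx i j => MvPolynomial.X a.1 ^ J a.1) fun a _ => hX a

theorem mem_pow_iff {l : Gr24} {i j : Fin 4} (h : l.plucker (i, j) ≠ 0) (k : ℕ)
    (q : MvPolynomial (Fin 4) ℂ) :
    sg i j l q ∈ MvPolynomial.vanishingIdeal ℂ (l.1 : Set (Fin 4 → ℂ)) ^ k ↔
      q ∈ stdIdeal i j ^ k := by
  rw [vanishingIdeal_eq h, ← Ideal.map_pow,
    Ideal.mem_map_iff_of_surjective _ fun p => ⟨_, sg_tu i j l p⟩]
  constructor
  · rintro ⟨r, hr, h1⟩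
    rwa [← tu_sg i j l q, ← h1, tu_sg]
  · intro hq
    exact ⟨q, hq, rfl⟩

/-- The exponents of the frame of `V_{k,d}`. -/
abbrev vIdx (i j : Fin 4) (k d : ℕ) : Type :=
  {J : Finset.finsuppAntidiag (Finset.univ : Finset (Fin 4)) d // k ≤ wt i j J.1}

theorem monomial_homogeneous {d : ℕ} (J : Finset.finsuppAntidiag (Finset.univ : Finset (Fin 4)) d) :
    (MvPolynomial.monomial J.1 (1 : ℂ)).IsHomogeneous d := by
  apply MvPolynomial.isHomogeneous_monomial
  rw [Finsupp.degree_eq_sum]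
  exact (Finset.mem_finsuppAntidiag.1 J.2).1

theorem eq_sum_monomial {d : ℕ} {q : MvPolynomial (Fin 4) ℂ} (hq : q.IsHomogeneous d) :
    q = ∑ J : Finset.finsuppAntidiag (Finset.univ : Finset (Fin 4)) d,
      q.coeff J.1 • MvPolynomial.monomial J.1 1 := by
  rw [Finset.sum_coe_sort (Finset.finsuppAntidiag (Finset.univ : Finset (Fin 4)) d)
    (fun J => q.coeff J • MvPolynomial.monomial J (1 : ℂ))]
  ext K
  simp only [MvPolynomial.coeff_sum, MvPolynomial.coeff_smul, MvPolynomial.coeff_monomial,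
    smul_eq_mul, mul_ite, mul_one, mul_zero, Finset.sum_ite_eq']
  split_ifs with hK
  · rfl
  · apply hq.coeff_eq_zero
    intro hd
    apply hK
    rw [Finset.mem_finsuppAntidiag]
    exact ⟨by rw [← hd, Finsupp.degree_eq_sum], Finset.subset_univ _⟩

theorem sg_monomial_mem {l : Gr24} {i j : Fin 4} (h : l.plucker (i, j) ≠ 0) {k d : ℕ}
    (J : vIdx i j k d) : sg i j l (MvPolynomial.monomial J.1.1 1) ∈ vanishingPolys k d l :=
  ⟨sub_homogeneous (monomial_homogeneous J.1), (mem_pow_iff h k _).2 (monomial_mem J.2)⟩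

theorem eq_sum_sg {l : Gr24} {i j : Fin 4} (h : l.plucker (i, j) ≠ 0) {k d : ℕ}
    {p : MvPolynomial (Fin 4) ℂ} (hp : p ∈ vanishingPolys k d l) :
    p = ∑ J : vIdx i j k d, (tu i j l p).coeff J.1.1 • sg i j l (MvPolynomial.monomial J.1.1 1) := by
  classical
  have h1 : (tu i j l p).IsHomogeneous d := sub_homogeneous hp.1
  have h2 : tu i j l p ∈ stdIdeal i j ^ k := by
    rw [← mem_pow_iff h, sg_tu]
    exact hp.2
  conv_lhs => rw [← sg_tu i j l p, eq_sum_monomial h1, map_sum]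
  have h3 : ∀ J ∈ (Finset.univ : Finset (Finset.finsuppAntidiag (Finset.univ : Finset (Fin 4)) d)),
      sg i j l ((tu i j l p).coeff J.1 • MvPolynomial.monomial J.1 1) ≠ 0 → k ≤ wt i j J.1 := by
    intro J _ hJ
    refine stdIdeal_pow_wt i j k _ h2 _ fun h0 => hJ ?_
    rw [h0, zero_smul, map_zero]
  rw [← Finset.sum_filter_of_ne h3,
    Finset.sum_subtype (F := inferInstance) (p := fun J => k ≤ wt i j J.1) _ (by simp)]
  simp only [map_smul]

/-- The bundle `V_{k,d}` of homogeneous polynomials of degree `d` that vanish on `l` to order `k`: a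
subbundle of the trivial bundle with fibre the polynomials of degree `d`, so that a section is
regular when its coefficients are. -/
def vBundle (k d : ℕ) : AlgVectorBundle Gr24 where
  fiber l := vanishingPolys k d l
  IsReg l s := ∀ J : Fin 4 →₀ ℕ, (fun m => (s m).1.coeff J) ∈ SpaceWithFunctions.regAt l
  exists_frame l := by
    classical
    obtain ⟨i, j, h⟩ := exists_plucker_ne l
    refine ⟨vIdx i j k d, inferInstance, fun J m => if hm : m.plucker (i, j) ≠ 0 then
      ⟨sg i j m (MvPolynomial.monomial J.1.1 1), sg_monomial_mem hm J⟩ else 0, ?_⟩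
    filter_upwards [eventually_plucker_ne h] with y hy
    have he : ∀ m : Gr24, m.plucker (i, j) ≠ 0 → ∀ J : vIdx i j k d,
        ((if hm : m.plucker (i, j) ≠ 0 then ⟨sg i j m (MvPolynomial.monomial J.1.1 1),
          sg_monomial_mem hm J⟩ else 0 : vanishingPolys k d m) : MvPolynomial (Fin 4) ℂ) =
          sg i j m (MvPolynomial.monomial J.1.1 1) := by
      intro m hm J
      rw [dif_pos hm]
    refine ⟨?_, ?_, fun s => ⟨fun hs => ?_, ?_⟩⟩
    · rw [Fintype.linearIndependent_iff]
      intro g hg K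
      have h1 := congrArg (fun p : vanishingPolys k d y =>
        (tu i j y (p : MvPolynomial (Fin 4) ℂ)).coeff K.1.1) hg
      simp only [Submodule.coe_sum, Submodule.coe_smul, he y hy, map_sum, map_smul, tu_sg,
        MvPolynomial.coeff_sum, MvPolynomial.coeff_smul, MvPolynomial.coeff_monomial] at h1
      simpa [← Subtype.ext_iff] using h1
    · rintro ⟨p, hp⟩ -
      refine (Submodule.mem_span_range_iff_exists_fun ℂ).2
        ⟨fun J => (tu i j y p).coeff J.1.1, Subtype.ext ?_⟩
      simp only [Submodule.coe_sum, Submodule.coe_smul, he y hy]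
      exact (eq_sum_sg hy hp).symm
    · refine ⟨fun J m => (tu i j m (s m).1).coeff J.1.1, fun J => ?_, ?_⟩
      · have h1 : (∑ K : Finset.finsuppAntidiag (Finset.univ : Finset (Fin 4)) d,
            (fun m => (s m).1.coeff K.1) * fun m =>
              (tu i j m (MvPolynomial.monomial K.1 1)).coeff J.1.1) ∈
            SpaceWithFunctions.regAt y :=
          sum_mem fun K _ => mul_mem (hs K.1) (coeff_sub_regular i j
            (fun a => neg_mem (cf_regular hy a)) (fun a => neg_mem (cf'_regular hy a)) _ _)
        convert h1 using 1
        funext m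
        dsimp only
        conv_lhs => rw [eq_sum_monomial (s m).2.1]
        simp [MvPolynomial.coeff_sum]
      · filter_upwards [eventually_plucker_ne hy] with m hm
        apply Subtype.ext
        simp only [Submodule.coe_sum, Submodule.coe_smul, he m hm]
        exact eq_sum_sg hm (s m).2
    · rintro ⟨c, hc, hs⟩ K
      have h1 : (∑ J : vIdx i j k d, c J * fun m =>
          (sg i j m (MvPolynomial.monomial J.1.1 1)).coeff K) ∈ SpaceWithFunctions.regAt y :=
        sum_mem fun J _ => mul_mem (hc J) (coeff_sub_regular i j
          (fun a => cf_regular hy a) (fun a => cf'_regular hy a) _ _)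
      refine SpaceWithFunctions.regAt_congr ?_ h1
      filter_upwards [hs, eventually_plucker_ne hy] with m hm1 hm2
      rw [hm1]
      simp only [Submodule.coe_sum, Submodule.coe_smul, he m hm2, Finset.sum_apply,
        MvPolynomial.coeff_sum, MvPolynomial.coeff_smul, Pi.mul_apply, smul_eq_mul]

end Gr24

/-- The binomial coefficient of an integer `n`, with the convention that it vanishes for `n < 0`. -/
def binom (n : ℤ) (r : ℕ) : ℕ := if 0 ≤ n then n.toNat.choose r else 0

end

/-!
The formula comes from a resolution of `V_{k,d}` by bundles whose classes are known. Put
`d = k + e`, and let `S_e` be the space of forms of degree `e` in four variables. Multiplying out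
maps `Symᵏν ⊗ S_e` onto `V_{k,d}`, because the ideal of `l` is generated by the linear forms in the
fibre of `ν`. Two such forms `f`, `g` that span the fibre are part of a coordinate system, so that
the only relations between the products `fⁱgᵏ⁻ⁱ` are the multiples of the Koszul relation
`x ⊗ g - y ⊗ f`, where `x`, `y` denote `f`, `g` as elements of `ν`. Hence

`0 → ⋀²ν ⊗ Symᵏ⁻¹ν ⊗ S_{e-1} → Symᵏν ⊗ S_e → V_{k,d} → 0`

is exact (`Gr24.isShortExact_koszul`), and the binomial coefficients are the dimensions of `S_e` and
`S_{e-1}`. For `d < k` both sides vanish.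

Tensor products with the trivial bundles `S_e` and `S_{e-1}` are written as direct sums of copies
indexed by the monomials (`AlgVectorBundle.piBundle`). On a fibre, a family indexed by the monomials
becomes a polynomial with coefficients in the symmetric algebra (`toPoly`), and the first map
becomes multiplication by `x ⊗ g - y ⊗ f` (`toPoly_koszulDifferential`). It is injective since the
polynomials over a symmetric algebra form a domain, and exactness in the middle is
`exists_eq_koszulElement_mul`.
-/

noncomputable section

open SpaceWithFunctions AlgVectorBundle

/-! ### Direct powers of a bundle -/

namespace AlgVectorBundle

variable {X : Type} [SpaceWithFunctions X]

theorem IsReg.sum {E : AlgVectorBundle X} {x : X} {κ : Type} (S : Finset κ)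
    {s : κ → ∀ x, E.fiber x} (h : ∀ k ∈ S, E.IsReg x (s k)) :
    E.IsReg x (fun y => ∑ k ∈ S, s k y) := by
  classical
  induction S using Finset.induction_on with
  | empty => exact E.isReg_zero
  | insert a S ha ih =>
    simp only [Finset.sum_insert ha]
    exact (h _ (by simp)).add (ih fun k hk => h k (by simp [hk]))

/-- The direct sum of copies of `E` indexed by `ι`: a section is regular when its components are. -/
def piBundle (ι : Type) [Fintype ι] (E : AlgVectorBundle X) : AlgVectorBundle X where
  fiber x := ι → E.fiber x
  IsReg x s := ∀ i, E.IsReg x fun y => s y i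
  exists_frame x := by
    classical
    obtain ⟨κ, _, e, he⟩ := E.exists_frame x
    refine ⟨Σ _ : ι, κ, inferInstance, fun p y => Pi.single p.1 (e p.2 y), ?_⟩
    filter_upwards [he] with y ⟨he1, he2, he3⟩
    have hb : (fun p : Σ _ : ι, κ => (Pi.single p.1 (e p.2 y) : ι → E.fiber y)) =
        Pi.basis fun _ : ι => Module.Basis.mk he1 he2 := by
      funext p
      simp [Pi.basis_apply]
    have hsum : ∀ (c : (Σ _ : ι, κ) → ℂ) (z : X) (i : ι),
        (∑ p : Σ _ : ι, κ, c p • (Pi.single p.1 (e p.2 z) : ι → E.fiber z)) i =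
          ∑ j, c ⟨i, j⟩ • e j z := by
      intro c z i
      rw [Fintype.sum_sigma, Finset.sum_apply, Finset.sum_eq_single i]
      · simp
      · intro b _ hb
        simp [hb.symm]
      · simp
    refine ⟨?_, ?_, fun s => ⟨fun hs => ?_, ?_⟩⟩
    · rw [hb]
      exact Module.Basis.linearIndependent _
    · rw [hb]
      exact (Module.Basis.span_eq _).ge
    · choose c hc h using fun i => (he3 _).1 (hs i)
      refine ⟨fun p => c p.1 p.2, fun p => hc _ _, ?_⟩
      filter_upwards [eventually_all.2 h] with z hz
      funext i
      rw [hsum]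
      exact hz i
    · rintro ⟨c, hc, h⟩ i
      refine (he3 _).2 ⟨fun j => c ⟨i, j⟩, fun j => hc _, ?_⟩
      filter_upwards [h] with z hz
      rw [hz, hsum]

/-- By induction on `ι`: one copy of `E` splits off from the sum over `Option α`. -/
theorem cls_piBundle (ι : Type) [Fintype ι] (E : AlgVectorBundle X) :
    K0.cls (piBundle ι E) = Fintype.card ι • K0.cls E := by
  refine Fintype.induction_empty_option
    (P := fun ι _ => K0.cls (piBundle ι E) = Fintype.card ι • K0.cls E) ?_ ?_ ?_ ι
  · intro α β _ e h
    let _ : Fintype α := Fintype.ofEquiv β e.symm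
    rw [← Fintype.card_congr e, ← h]
    refine K0.cls_eq_of_bijective (E := piBundle β E) (F := piBundle α E)
      ⟨fun x => (LinearEquiv.funCongrLeft ℂ (E.fiber x) e).toLinearMap, fun x s hs i => hs (e i)⟩
      fun x => (LinearEquiv.funCongrLeft ℂ (E.fiber x) e).bijective
  · rw [Fintype.card_pempty, zero_smul, ← K0.cls_zeroBundle]
    exact K0.cls_eq_of_bijective (E := piBundle PEmpty E) (F := zeroBundle X)
      ⟨fun _ => 0, fun _ _ _ => trivial⟩
      fun x => ⟨fun _ _ _ => funext fun i => i.elim, fun _ => ⟨0, rfl⟩⟩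
  · intro α _ h
    classical
    rw [Fintype.card_option, succ_nsmul', ← h]
    refine K0.cls_exact (E' := E) (E := piBundle (Option α) E) (E'' := piBundle α E)
      ⟨fun x => LinearMap.single ℂ (fun _ => E.fiber x) none, fun x s hs i => ?_⟩
      ⟨fun x => LinearMap.funLeft ℂ (E.fiber x) some, fun x s hs i => hs (some i)⟩
      fun x => ⟨?_, ?_, ?_⟩
    · cases i with
      | none => exact hs.congr (Eventually.of_forall fun y =>
          (Pi.single_eq_same (M := fun _ : Option α => E.fiber y) none (s y)).symm)
      | some a => exact E.isReg_zero.congr (Eventually.of_forall fun y =>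
          (Pi.single_eq_of_ne (M := fun _ : Option α => E.fiber y) (Option.some_ne_none a)
            (s y)).symm)
    · exact Pi.single_injective (M := fun _ : Option α => E.fiber x) none
    · intro v
      constructor
      · intro hv
        refine ⟨v none, funext fun i => ?_⟩
        cases i with
        | none => exact Pi.single_eq_same (M := fun _ : Option α => E.fiber x) none (v none)
        | some a =>
          exact (Pi.single_eq_of_ne (M := fun _ : Option α => E.fiber x) (Option.some_ne_none a)
            (v none)).trans (congrFun hv a).symm
      · rintro ⟨w, rfl⟩
        exact funext fun a =>
          Pi.single_eq_of_ne (M := fun _ : Option α => E.fiber x) (Option.some_ne_none a) w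
    · intro w
      exact ⟨fun i => i.elim 0 w, rfl⟩

end AlgVectorBundle

/-! ### Contraction and multiplication -/

section LinearAlgebra

variable {M : Type} [AddCommGroup M] [Module ℂ M]

/-- The contraction `a ∧ b ↦ φ(b) a - φ(a) b` of a bivector with a functional. -/
def contraction (φ : M →ₗ[ℂ] ℂ) : ⋀[ℂ]^2 M →ₗ[ℂ] M :=
  exteriorPower.alternatingMapLinearEquiv
    { toFun := fun v => φ (v 1) • v 0 - φ (v 0) • v 1
      map_update_add' := by
        intro inst v i a b
        obtain rfl : inst = instDecidableEqFin 2 := Subsingleton.elim _ _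
        fin_cases i <;> simp [add_smul] <;> abel
      map_update_smul' := by
        intro inst v i c a
        obtain rfl : inst = instDecidableEqFin 2 := Subsingleton.elim _ _
        fin_cases i <;> simp [smul_sub, smul_smul, mul_comm]
      map_eq_zero_of_eq' := by
        intro v i j h hij
        have h01 : v 0 = v 1 := by
          fin_cases i <;> fin_cases j <;> simp_all
        simp [h01] }

theorem contraction_ιMulti (φ : M →ₗ[ℂ] ℂ) (v : Fin 2 → M) :
    contraction φ (exteriorPower.ιMulti ℂ 2 v) = φ (v 1) • v 0 - φ (v 0) • v 1 := by
  rw [contraction, exteriorPower.alternatingMapLinearEquiv_apply_ιMulti]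
  rfl

theorem ι_mul_mem_symPart {k : ℕ} (a : M) {s : SymmetricAlgebra ℂ M} (hs : s ∈ SymPart k M) :
    SymmetricAlgebra.ι ℂ M a * s ∈ SymPart (k + 1) M := by
  rw [SymPart, pow_succ']
  exact Submodule.mul_mem_mul ⟨a, rfl⟩ hs

/-- Multiplication of a vector with an element of a symmetric power. -/
def symCons (k : ℕ) : M →ₗ[ℂ] SymPart k M →ₗ[ℂ] SymPart (k + 1) M :=
  LinearMap.mk₂ ℂ (fun a s => ⟨SymmetricAlgebra.ι ℂ M a * s.1, ι_mul_mem_symPart a s.2⟩)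
    (fun a b s => Subtype.ext (by simp [add_mul]))
    (fun c a s => Subtype.ext (by simp))
    (fun a s t => Subtype.ext (by simp [mul_add]))
    (fun c a s => Subtype.ext (by simp))

@[simp] theorem coe_symCons {k : ℕ} (a : M) (s : SymPart k M) :
    (symCons k a s : SymmetricAlgebra ℂ M) = SymmetricAlgebra.ι ℂ M a * s := rfl

/-- One component of the Koszul differential:
`(a ∧ b) ⊗ s ↦ (φ(b) a - φ(a) b) s`. -/
def koszulComponent (k : ℕ) (φ : M →ₗ[ℂ] ℂ) : ⋀[ℂ]^2 M ⊗[ℂ] SymPart k M →ₗ[ℂ] SymPart (k + 1) M :=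
  TensorProduct.lift (symCons k ∘ₗ contraction φ)

end LinearAlgebra

theorem AlgVectorBundle.isReg_symCons {X : Type} [SpaceWithFunctions X] {E : AlgVectorBundle X}
    {k : ℕ} {x : X} {a : ∀ y, E.fiber y} {s : ∀ y, SymPart k (E.fiber y)} (ha : E.IsReg x a)
    (hs : (symPow k E).IsReg x s) :
    (symPow (k + 1) E).IsReg x fun y => symCons k (a y) (s y) := by
  refine GenReg.map (gen := symGen E k) (symPow (k + 1) E) (fun y => symCons k (a y)) ?_ hs
  rintro _ ⟨b, hb, rfl⟩
  refine GenReg.of _ ⟨Fin.cons a b, fun j => ?_, ?_⟩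
  · cases j using Fin.cases with
    | zero => exact ha
    | succ j => exact hb j
  · funext y
    apply Subtype.ext
    refine (coe_symCons (a y) _).trans ?_
    simp [symMul, Fin.prod_univ_succ]

namespace Gr24

/-- Evaluation of the linear forms in the fibre of `ν` at the vector `v`. -/
def evalAt (l : Gr24) (v : Fin 4 → ℂ) : nu.fiber l →ₗ[ℂ] ℂ :=
  (LinearMap.applyₗ v).comp (Submodule.subtype l.1.dualAnnihilator)

/-- The contraction of `a ∧ b` with evaluation at `v` is `b(v) a - a(v) b`, and the values of
regular sections of `ν` at a fixed vector are regular functions. -/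
theorem isReg_contraction (v : Fin 4 → ℂ) {l : Gr24} {s : ∀ m : Gr24, ⋀[ℂ]^2 (nu.fiber m)}
    (hs : (extPow 2 nu).IsReg l s) :
    nu.IsReg l fun m => contraction (evalAt m v) (s m) := by
  refine GenReg.map (gen := extGen nu 2) nu (fun m => contraction (evalAt m v)) ?_ hs
  rintro _ ⟨a, ha, rfl⟩
  intro w
  have h : ((fun m => (a 1 m).1 v) * (fun m => (a 0 m).1 w) -
      (fun m => (a 0 m).1 v) * (fun m => (a 1 m).1 w)) ∈ SpaceWithFunctions.regAt l :=
    sub_mem (mul_mem (ha 1 v) (ha 0 w)) (mul_mem (ha 0 v) (ha 1 w))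
  convert h using 1
  funext m
  exact congrArg (fun φ : m.1.dualAnnihilator => φ.1 w)
    (contraction_ιMulti (evalAt m v) fun j => a j m)

/-- The component of the Koszul differential that is given by evaluation at `v`, as a morphism of
bundles `⋀²ν ⊗ Symᵏν → Symᵏ⁺¹ν`. -/
def koszulHom (k : ℕ) (v : Fin 4 → ℂ) :
    Hom (tensor (extPow 2 nu) (symPow k nu)) (symPow (k + 1) nu) :=
  tensorHom (symPow (k + 1) nu) (fun l => koszulComponent k (evalAt l v)) fun _ _ _ ha hb =>
    isReg_symCons (isReg_contraction v ha) hb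

end Gr24

/-! ### The Koszul relation on powers of an ideal with two generators -/

section Koszul

open MvPolynomial

variable {σ : Type} {M : Type} [AddCommGroup M] [Module ℂ M]

/-- The quotient of a form of degree `e` by a linear form is a form of degree `e - 1`; for `e = 0`
it has no monomials at all. -/
theorem exists_eq_mul_of_dvd {f c : MvPolynomial σ ℂ} {e : ℕ} (hf : f.IsHomogeneous 1)
    (hc : c.IsHomogeneous e) (h : f ∣ c) :
    ∃ q, c = f * q ∧ ∀ J, q.coeff J ≠ 0 → J.degree + 1 = e := by
  let _ : GradedAlgebra (homogeneousSubmodule σ ℂ) := gradedAlgebra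
  obtain ⟨q, rfl⟩ := h
  have h0 : homogeneousComponent e (f * q) = f * q := homogeneousComponent_eq_self hc
  rw [← decomposition.decompose'_apply] at h0
  cases e with
  | zero =>
    refine ⟨0, ?_, fun J hJ => (hJ (coeff_zero J)).elim⟩
    rw [← h0, mul_zero]
    exact DirectSum.coe_decompose_mul_of_left_mem_of_not_le (homogeneousSubmodule σ ℂ)
      (i := 1) (n := 0) (a := f) (b := q) hf (by simp)
  | succ e =>
    refine ⟨homogeneousComponent e q, ?_, fun J hJ => ?_⟩
    · rw [← h0, add_comm e 1, ← decomposition.decompose'_apply]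
      exact DirectSum.coe_decompose_mul_add_of_left_mem (homogeneousSubmodule σ ℂ)
        (i := 1) (j := e) (a := f) (b := q) hf
    · rw [coeff_homogeneousComponent] at hJ
      by_contra hne
      exact hJ (if_neg fun h => hne (by rw [h]))

variable {x y : M}

/-- `Symᵏ⁺¹M = x Symᵏ M + ℂ yᵏ⁺¹` when `x` and `y` span `M`. -/
theorem exists_symPart_decomposition (hspan : ∀ m : M, ∃ a b : ℂ, m = a • x + b • y) (k : ℕ) :
    ∀ v ∈ SymPart (k + 1) M, ∃ u ∈ SymPart k M, ∃ r : ℂ,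
      v = SymmetricAlgebra.ι ℂ M x * u + r • SymmetricAlgebra.ι ℂ M y ^ (k + 1) := by
  have hadd : ∀ k : ℕ, ∀ v w : SymmetricAlgebra ℂ M,
      (∃ u ∈ SymPart k M, ∃ r : ℂ,
        v = SymmetricAlgebra.ι ℂ M x * u + r • SymmetricAlgebra.ι ℂ M y ^ (k + 1)) →
      (∃ u ∈ SymPart k M, ∃ r : ℂ,
        w = SymmetricAlgebra.ι ℂ M x * u + r • SymmetricAlgebra.ι ℂ M y ^ (k + 1)) →
      ∃ u ∈ SymPart k M, ∃ r : ℂ,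
        v + w = SymmetricAlgebra.ι ℂ M x * u + r • SymmetricAlgebra.ι ℂ M y ^ (k + 1) := by
    rintro k _ _ ⟨u, hu, r, rfl⟩ ⟨u', hu', r', rfl⟩
    exact ⟨u + u', add_mem hu hu', r + r', by rw [mul_add, add_smul]; abel⟩
  induction k with
  | zero =>
    intro v hv
    rw [SymPart, zero_add, pow_one] at hv
    obtain ⟨m, rfl⟩ := hv
    obtain ⟨a, b, rfl⟩ := hspan m
    refine ⟨algebraMap ℂ _ a, by simp [SymPart], b, ?_⟩
    simp [Algebra.smul_def, mul_comm]
  | succ k ih =>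
    intro v hv
    rw [SymPart, pow_succ'] at hv
    refine Submodule.mul_induction_on hv ?_ (hadd (k + 1))
    rintro _ ⟨m, rfl⟩ w hw
    obtain ⟨a, b, rfl⟩ := hspan m
    obtain ⟨u, hu, r, hwu⟩ := ih w hw
    refine ⟨a • w + b • (SymmetricAlgebra.ι ℂ M y * u),
      add_mem (Submodule.smul_mem _ _ hw) (Submodule.smul_mem _ _ (ι_mul_mem_symPart y hu)),
      b * r, ?_⟩
    rw [map_add, map_smul, map_smul, add_mul, smul_mul_assoc, smul_mul_assoc, mul_add,
      mul_smul_comm, mul_smul_comm, add_assoc]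
    congr 1
    conv_lhs => rw [hwu]
    rw [mul_add, mul_smul_comm, smul_add, smul_smul, ← pow_succ']
    congr 2
    ring

/-- The element `x ⊗ g - y ⊗ f`, as a polynomial with coefficients in the symmetric algebra. If `x`
and `y` are sent to `f` and `g`, its multiples are relations between the products `fⁱgᵏ⁻ⁱ`. -/
def koszulElement (x y : M) (f g : MvPolynomial σ ℂ) : MvPolynomial σ (SymmetricAlgebra ℂ M) :=
  C (SymmetricAlgebra.ι ℂ M x) * map (algebraMap ℂ _) g -
    C (SymmetricAlgebra.ι ℂ M y) * map (algebraMap ℂ _) f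

/-- The map `Sym M ⊗ S → S` that multiplies out, where `S` is the polynomial ring and `M` is mapped
to `S` by `L`. -/
def multiplyOut (L : M →ₗ[ℂ] MvPolynomial σ ℂ) :
    MvPolynomial σ (SymmetricAlgebra ℂ M) →+* MvPolynomial σ ℂ :=
  eval₂Hom (SymmetricAlgebra.lift L).toRingHom X

variable (L : M →ₗ[ℂ] MvPolynomial σ ℂ)

theorem multiplyOut_monomial (J : σ →₀ ℕ) (v : SymmetricAlgebra ℂ M) :
    multiplyOut L (monomial J v) = monomial J 1 * SymmetricAlgebra.lift L v := by
  rw [multiplyOut, coe_eval₂Hom, eval₂_monomial, mul_comm, monomial_eq (s := J) (a := (1 : ℂ)),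
    map_one, one_mul]
  rfl

@[simp] theorem multiplyOut_C (v : SymmetricAlgebra ℂ M) :
    multiplyOut L (C v) = SymmetricAlgebra.lift L v := by
  simp [multiplyOut]

@[simp] theorem multiplyOut_map (p : MvPolynomial σ ℂ) :
    multiplyOut L (map (algebraMap ℂ _) p) = p := by
  have h : (SymmetricAlgebra.lift L).toRingHom.comp
      (algebraMap ℂ (SymmetricAlgebra ℂ M)) = C := by
    ext a
    simp
  rw [multiplyOut, coe_eval₂Hom, eval₂_map, h, eval₂_eta]

theorem multiplyOut_koszulElement : multiplyOut L (koszulElement x y (L x) (L y)) = 0 := by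
  simp [koszulElement, mul_comm]

/-- If the linear form `L x` is prime and does not divide `L y`, then every form of bidegree
`(k + 1, e)` that multiplies out to zero is a multiple of the Koszul element. The proof strips off
the coefficient `c` of `yᵏ⁺¹`: it is divisible by `L x`, so that a multiple of the Koszul element
removes it, and the remainder is `x` times a form of bidegree `(k, e)`. -/
theorem exists_eq_koszulElement_mul (hspan : ∀ m : M, ∃ a b : ℂ, m = a • x + b • y)
    (hx : Prime (L x)) (hxy : ¬ L x ∣ L y) (hLx : (L x).IsHomogeneous 1)
    (hLy : (L y).IsHomogeneous 1) (e k : ℕ) :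
    ∀ P : MvPolynomial σ (SymmetricAlgebra ℂ M), (∀ J, P.coeff J ∈ SymPart (k + 1) M) →
      P.IsHomogeneous e → multiplyOut L P = 0 →
      ∃ Q, P = koszulElement x y (L x) (L y) * Q ∧ (∀ J, Q.coeff J ∈ SymPart k M) ∧
        ∀ J, Q.coeff J ≠ 0 → J.degree + 1 = e := by
  -- The induction on `k` needs only that `x` times the coefficients of `Q` lie in `Symᵏ M`. In this
  -- form the claim also makes sense for `P` of bidegree `(0, e)`, where it starts.
  have hweak : ∀ P : MvPolynomial σ (SymmetricAlgebra ℂ M), (∀ J, P.coeff J ∈ SymPart 0 M) →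
      P.IsHomogeneous e → multiplyOut L P = 0 →
      ∃ Q, P = koszulElement x y (L x) (L y) * Q ∧
        (∀ J, SymmetricAlgebra.ι ℂ M x * Q.coeff J ∈ SymPart 0 M) ∧
        ∀ J, Q.coeff J ≠ 0 → J.degree + 1 = e := by
    intro P hP _ h0
    obtain ⟨c, rfl⟩ : ∃ c : MvPolynomial σ ℂ,
        MvPolynomial.map (algebraMap ℂ (SymmetricAlgebra ℂ M)) c = P := by
      refine mem_range_map_iff_coeffs_subset.2 ?_
      intro v hv
      obtain ⟨J, _, rfl⟩ := mem_coeffs_iff.1 hv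
      have h := hP J
      rw [SymPart, pow_zero, Submodule.mem_one] at h
      exact h
    rw [multiplyOut_map] at h0
    exact ⟨0, by simp [h0], by simp, by simp⟩
  have hstep : ∀ k, (∀ P : MvPolynomial σ (SymmetricAlgebra ℂ M),
      (∀ J, P.coeff J ∈ SymPart k M) → P.IsHomogeneous e → multiplyOut L P = 0 →
      ∃ Q, P = koszulElement x y (L x) (L y) * Q ∧
        (∀ J, SymmetricAlgebra.ι ℂ M x * Q.coeff J ∈ SymPart k M) ∧
        ∀ J, Q.coeff J ≠ 0 → J.degree + 1 = e) →
      ∀ P : MvPolynomial σ (SymmetricAlgebra ℂ M), (∀ J, P.coeff J ∈ SymPart (k + 1) M) →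
        P.IsHomogeneous e → multiplyOut L P = 0 →
        ∃ Q, P = koszulElement x y (L x) (L y) * Q ∧ (∀ J, Q.coeff J ∈ SymPart k M) ∧
          ∀ J, Q.coeff J ≠ 0 → J.degree + 1 = e := by
    intro k ih P hP hPe h0
    have hy : SymmetricAlgebra.ι ℂ M y ^ k ∈ SymPart k M :=
      Submodule.pow_mem_pow _ (LinearMap.mem_range_self _ y) k
    choose u hu r hur using fun J => exists_symPart_decomposition hspan k _ (hP J)
    have hdeg : ∀ J ∈ P.support, J.degree = e := fun J hJ => by
      by_contra h
      exact mem_support_iff.1 hJ (hPe.coeff_eq_zero h)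
    let P₁ : MvPolynomial σ (SymmetricAlgebra ℂ M) := ∑ J ∈ P.support, monomial J (u J)
    let c : MvPolynomial σ ℂ := ∑ J ∈ P.support, monomial J (r J)
    have hPc : P = C (SymmetricAlgebra.ι ℂ M x) * P₁ +
        C (SymmetricAlgebra.ι ℂ M y ^ (k + 1)) * map (algebraMap ℂ _) c := by
      conv_lhs => rw [P.as_sum]
      simp only [P₁, c, map_sum, Finset.mul_sum, ← Finset.sum_add_distrib, map_monomial,
        C_mul_monomial, ← map_add]
      refine Finset.sum_congr rfl fun J _ => congrArg _ ((hur J).trans ?_)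
      rw [Algebra.smul_def, mul_comm (algebraMap _ _ _)]
    have hP₁ : P₁.IsHomogeneous e :=
      IsHomogeneous.sum _ _ _ fun J hJ => isHomogeneous_monomial _ (hdeg J hJ)
    have hc : c.IsHomogeneous e :=
      IsHomogeneous.sum _ _ _ fun J hJ => isHomogeneous_monomial _ (hdeg J hJ)
    have h1 : L x * multiplyOut L P₁ + L y ^ (k + 1) * c = 0 := by
      rw [← h0]
      conv_rhs => rw [hPc]
      simp
    -- Modulo `L x`, the relation says that `(L y)ᵏ⁺¹ c` vanishes.
    have h2 : L x ∣ c := by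
      have h3 : L x ∣ L y ^ (k + 1) * c :=
        ⟨-multiplyOut L P₁, by linear_combination h1⟩
      exact (hx.dvd_or_dvd h3).resolve_left fun h => hxy (hx.dvd_of_dvd_pow h)
    obtain ⟨q, hq, hqe⟩ := exists_eq_mul_of_dvd hLx hc h2
    have hyq : (L y * q).IsHomogeneous e := by
      cases e with
      | zero =>
        have : q = 0 := by
          ext J
          by_contra h
          exact Nat.succ_ne_zero _ (hqe J h)
        rw [this, mul_zero]
        exact isHomogeneous_zero _ _ _
      | succ e =>
        rw [add_comm]
        refine hLy.mul ?_
        rw [q.as_sum]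
        exact IsHomogeneous.sum _ _ _ fun J hJ =>
          isHomogeneous_monomial _ (Nat.succ_injective (hqe J (mem_support_iff.1 hJ)))
    let P₂ := P₁ + C (SymmetricAlgebra.ι ℂ M y ^ k) * map (algebraMap ℂ _) (L y * q)
    have hPP : P = C (SymmetricAlgebra.ι ℂ M x) * P₂ - koszulElement x y (L x) (L y) *
        (C (SymmetricAlgebra.ι ℂ M y ^ k) * map (algebraMap ℂ _) q) := by
      rw [hPc, hq]
      simp only [P₂, koszulElement, map_mul, pow_succ]
      ring
    have hsmul : ∀ (p : MvPolynomial σ ℂ) (J : σ →₀ ℕ),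
        (C (SymmetricAlgebra.ι ℂ M y ^ k) * map (algebraMap ℂ (SymmetricAlgebra ℂ M)) p).coeff J =
          p.coeff J • SymmetricAlgebra.ι ℂ M y ^ k := by
      intro p J
      rw [coeff_C_mul, coeff_map, Algebra.smul_def, mul_comm]
    obtain ⟨Q, hQ, hQk, hQe⟩ := ih P₂ (fun J => by
        rw [coeff_add, hsmul]
        refine add_mem ?_ (Submodule.smul_mem _ _ hy)
        rw [coeff_sum]
        refine sum_mem fun K _ => ?_
        classical
        rw [coeff_monomial]
        split_ifs
        exacts [hu K, zero_mem _])
      (hP₁.add ((hyq.map _).C_mul _)) (by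
        have h4 : L x * multiplyOut L P₂ = 0 := by
          rw [← h1, hq]
          simp only [P₂, map_add, map_mul, multiplyOut_C, multiplyOut_map, map_pow,
            SymmetricAlgebra.lift_ι_apply]
          ring
        exact (mul_eq_zero.1 h4).resolve_left hx.ne_zero)
    refine ⟨C (SymmetricAlgebra.ι ℂ M x) * Q -
      C (SymmetricAlgebra.ι ℂ M y ^ k) * map (algebraMap ℂ _) q, ?_, fun J => ?_, fun J hJ => ?_⟩
    · rw [hPP, hQ]
      ring
    · rw [coeff_sub, hsmul, coeff_C_mul]
      exact sub_mem (hQk J) (Submodule.smul_mem _ _ hy)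
    · rw [coeff_sub, hsmul, coeff_C_mul] at hJ
      by_cases h : Q.coeff J = 0
      · refine hqe J fun h' => hJ ?_
        rw [h, h', mul_zero, zero_smul, sub_zero]
      · exact hQe J h
  induction k with
  | zero => exact hstep 0 hweak
  | succ k ih =>
    refine hstep (k + 1) fun P hP hPe h0 => ?_
    obtain ⟨Q, hQ, hQk, hQe⟩ := ih P hP hPe h0
    exact ⟨Q, hQ, fun J => ι_mul_mem_symPart x (hQk J), hQe⟩

end Koszul

/-! ### The Koszul complex of a space of linear forms -/

section KoszulComplex

open MvPolynomial

variable {σ : Type} {M : Type} [AddCommGroup M] [Module ℂ M] {k : ℕ}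
  {B B' : Finset (σ →₀ ℕ)}

/-- A family of elements of a symmetric power indexed by monomials, as a polynomial with
coefficients in the symmetric algebra. -/
def toPoly (s : B → SymPart k M) : MvPolynomial σ (SymmetricAlgebra ℂ M) :=
  ∑ J, monomial J.1 (s J).1

theorem coeff_toPoly (s : B → SymPart k M) (J : B) : (toPoly s).coeff J.1 = (s J).1 := by
  classical
  rw [toPoly, coeff_sum, Finset.sum_eq_single J]
  · simp
  · intro K _ hK
    rw [coeff_monomial, if_neg fun h => hK (Subtype.ext h)]
  · simp

theorem coeff_toPoly_of_notMem (s : B → SymPart k M) {J : σ →₀ ℕ} (hJ : J ∉ B) :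
    (toPoly s).coeff J = 0 := by
  classical
  rw [toPoly, coeff_sum]
  refine Finset.sum_eq_zero fun K _ => ?_
  rw [coeff_monomial, if_neg]
  rintro rfl
  exact hJ K.2

theorem toPoly_injective : Function.Injective (toPoly : (B → SymPart k M) → _) := by
  intro s t h
  funext J
  apply Subtype.ext
  rw [← coeff_toPoly s, ← coeff_toPoly t, h]

theorem coeff_toPoly_mem (s : B → SymPart k M) (J : σ →₀ ℕ) : (toPoly s).coeff J ∈ SymPart k M := by
  by_cases hJ : J ∈ B
  · rw [coeff_toPoly s ⟨J, hJ⟩]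
    exact (s _).2
  · rw [coeff_toPoly_of_notMem s hJ]
    exact zero_mem _

theorem exists_toPoly_eq {P : MvPolynomial σ (SymmetricAlgebra ℂ M)}
    (hP : ∀ J, P.coeff J ∈ SymPart k M) (hB : ∀ J, P.coeff J ≠ 0 → J ∈ B) :
    ∃ s : B → SymPart k M, toPoly s = P := by
  refine ⟨fun J => ⟨P.coeff J.1, hP J.1⟩, ?_⟩
  ext J
  by_cases hJ : J ∈ B
  · rw [coeff_toPoly _ ⟨J, hJ⟩]
  · rw [coeff_toPoly_of_notMem _ hJ]
    by_contra h
    exact hJ (hB J (Ne.symm h))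

/-- The map `(s_J) ↦ ∑ X^J s_J`, where the symmetric algebra of `M` is mapped to the polynomial ring
by extending `L`. -/
def multiplyForms (L : M →ₗ[ℂ] MvPolynomial σ ℂ) (B : Finset (σ →₀ ℕ)) (k : ℕ) :
    (B → SymPart k M) →ₗ[ℂ] MvPolynomial σ ℂ :=
  ∑ J : B, LinearMap.mulLeft ℂ (monomial J.1 1) ∘ₗ (SymmetricAlgebra.lift L).toLinearMap ∘ₗ
    (SymPart k M).subtype ∘ₗ LinearMap.proj J

theorem multiplyForms_apply (L : M →ₗ[ℂ] MvPolynomial σ ℂ) (s : B → SymPart k M) :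
    multiplyForms L B k s = ∑ J : B, monomial J.1 1 * SymmetricAlgebra.lift L (s J).1 := by
  simp [multiplyForms]

theorem multiplyForms_eq (L : M →ₗ[ℂ] MvPolynomial σ ℂ) (s : B → SymPart k M) :
    multiplyForms L B k s = multiplyOut L (toPoly s) := by
  rw [multiplyForms_apply, toPoly, map_sum]
  simp only [multiplyOut_monomial]

variable {x y : M}

/-- The exterior square of a space spanned by `x` and `y` is spanned by `x ∧ y`. -/
theorem exists_eq_ιMulti_tmul (hspan : ∀ m : M, ∃ a b : ℂ, m = a • x + b • y) {N : Type}
    [AddCommGroup N] [Module ℂ N] (t : ⋀[ℂ]^2 M ⊗[ℂ] N) :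
    ∃ n, t = exteriorPower.ιMulti ℂ 2 ![x, y] ⊗ₜ n := by
  have hw : ∀ w : ⋀[ℂ]^2 M, ∃ c : ℂ, w = c • exteriorPower.ιMulti ℂ 2 ![x, y] := by
    intro w
    have hmem : w ∈ Submodule.span ℂ (Set.range (exteriorPower.ιMulti ℂ 2 (M := M))) := by
      rw [exteriorPower.ιMulti_span]
      trivial
    induction hmem using Submodule.span_induction with
    | mem w hw =>
      obtain ⟨v, rfl⟩ := hw
      obtain ⟨a, b, h0⟩ := hspan (v 0)
      obtain ⟨c, d, h1⟩ := hspan (v 1)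
      refine ⟨a * d - b * c, ?_⟩
      -- `(a x + b y) ∧ (c x + d y) = (ad - bc) x ∧ y`
      have hv : v = ![a • x + b • y, c • x + d • y] := by
        funext i
        fin_cases i
        exacts [h0, h1]
      apply Subtype.ext
      rw [hv]
      have hyx : ExteriorAlgebra.ι ℂ y * ExteriorAlgebra.ι ℂ x =
          -(ExteriorAlgebra.ι ℂ x * ExteriorAlgebra.ι ℂ y) := by
        rw [eq_neg_iff_add_eq_zero]
        exact ExteriorAlgebra.ι_add_mul_swap y x
      simp only [exteriorPower.ιMulti_apply_coe, ExteriorAlgebra.ιMulti_apply, Submodule.coe_smul]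
      simp [List.ofFn_succ, add_mul, mul_add, hyx, smul_smul, sub_smul]
      module
    | zero => exact ⟨0, by simp⟩
    | add u w _ _ hu hw =>
      obtain ⟨c, rfl⟩ := hu
      obtain ⟨d, rfl⟩ := hw
      exact ⟨c + d, (add_smul _ _ _).symm⟩
    | smul c w _ hw =>
      obtain ⟨d, rfl⟩ := hw
      exact ⟨c * d, smul_smul _ _ _⟩
  induction t using TensorProduct.induction_on with
  | zero => exact ⟨0, (TensorProduct.tmul_zero _ _).symm⟩
  | tmul w n =>
    obtain ⟨c, rfl⟩ := hw w
    exact ⟨c • n, TensorProduct.smul_tmul _ _ _⟩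
  | add s t hs ht =>
    obtain ⟨m, rfl⟩ := hs
    obtain ⟨n, rfl⟩ := ht
    exact ⟨m + n, (TensorProduct.tmul_add _ _ _).symm⟩

/-- Only the term `y ⊗ f` contributes to the coefficient at the monomial `J`. -/
theorem koszulElement_ne_zero (hy : y ≠ 0) {f g : MvPolynomial σ ℂ} {J : σ →₀ ℕ}
    (hf : f.coeff J = 1) (hg : g.coeff J = 0) : koszulElement x y f g ≠ 0 := by
  intro h
  have h1 := congrArg (coeff J) h
  rw [koszulElement, coeff_sub, coeff_C_mul, coeff_C_mul, coeff_map, coeff_map, hf, hg, map_zero,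
    mul_zero, map_one, mul_one, zero_sub, coeff_zero, neg_eq_zero] at h1
  refine hy ((Module.forall_dual_apply_eq_zero_iff ℂ y).1 fun ψ => ?_)
  rw [← SymmetricAlgebra.lift_ι_apply ψ y, h1, map_zero]

variable [Fintype σ]

/-- The linear form on `ℂ^σ` with coordinates `φ v m`. -/
def linearForm (φ : σ → M →ₗ[ℂ] ℂ) : M →ₗ[ℂ] MvPolynomial σ ℂ :=
  ∑ v, (φ v).smulRight (X v)

theorem linearForm_apply (φ : σ → M →ₗ[ℂ] ℂ) (m : M) : linearForm φ m = ∑ v, φ v m • X v := by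
  simp [linearForm]

theorem linearForm_isHomogeneous (φ : σ → M →ₗ[ℂ] ℂ) (m : M) :
    (linearForm φ m).IsHomogeneous 1 := by
  rw [linearForm_apply]
  refine IsHomogeneous.sum _ _ _ fun v _ => ?_
  rw [smul_eq_C_mul]
  exact isHomogeneous_C_mul_X _ _

theorem coeff_linearForm (φ : σ → M →ₗ[ℂ] ℂ) (m : M) (v : σ) :
    (linearForm φ m).coeff (Finsupp.single v 1) = φ v m := by
  classical
  rw [linearForm_apply, coeff_sum, Finset.sum_eq_single v]
  · simp
  · intro u _ hu
    rw [coeff_smul, coeff_X, if_neg fun h => hu (Finsupp.single_left_injective one_ne_zero h),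
      smul_zero]
  · simp

theorem map_linearForm (φ : σ → M →ₗ[ℂ] ℂ) (m : M) :
    map (algebraMap ℂ (SymmetricAlgebra ℂ M)) (linearForm φ m) =
      ∑ v, monomial (Finsupp.single v 1) (algebraMap ℂ _ (φ v m)) := by
  rw [linearForm_apply, map_sum]
  refine Finset.sum_congr rfl fun v _ => ?_
  rw [X, smul_monomial, map_monomial, smul_eq_mul, mul_one]

variable [DecidableEq σ]

/-- The Koszul differential `⋀²M ⊗ Symᵏ M ⊗ S → Symᵏ⁺¹ M ⊗ S`, where the forms in the polynomial
ring `S` are given by their coefficients: those of the source at the monomials in `B'`, and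
those of the target at the monomials in `B`. -/
def koszulDifferential (φ : σ → M →ₗ[ℂ] ℂ) (B B' : Finset (σ →₀ ℕ)) (k : ℕ) :
    (B' → ⋀[ℂ]^2 M ⊗[ℂ] SymPart k M) →ₗ[ℂ] (B → SymPart (k + 1) M) :=
  LinearMap.pi fun K => ∑ v, ∑ J : B',
    if J.1 + Finsupp.single v 1 = K.1 then koszulComponent k (φ v) ∘ₗ LinearMap.proj J else 0

theorem koszulDifferential_apply (φ : σ → M →ₗ[ℂ] ℂ) (t : B' → ⋀[ℂ]^2 M ⊗[ℂ] SymPart k M) (K : B) :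
    koszulDifferential φ B B' k t K = ∑ v, ∑ J : B',
      if J.1 + Finsupp.single v 1 = K.1 then koszulComponent k (φ v) (t J) else 0 := by
  simp only [koszulDifferential, LinearMap.pi_apply, LinearMap.sum_apply]
  refine Finset.sum_congr rfl fun v _ => Finset.sum_congr rfl fun J _ => ?_
  split_ifs <;> rfl

/-- On families `(x ∧ y) ⊗ n_J`, the Koszul differential is multiplication by the Koszul element. -/
theorem toPoly_koszulDifferential (φ : σ → M →ₗ[ℂ] ℂ) (x y : M)
    (hB : ∀ J ∈ B', ∀ v, J + Finsupp.single v 1 ∈ B) (n : B' → SymPart k M) :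
    toPoly (koszulDifferential φ B B' k fun J => exteriorPower.ιMulti ℂ 2 ![x, y] ⊗ₜ n J) =
      koszulElement x y (linearForm φ x) (linearForm φ y) * toPoly n := by
  have h1 : ∀ (v : σ) (J : B'),
      (koszulComponent k (φ v) (exteriorPower.ιMulti ℂ 2 ![x, y] ⊗ₜ n J)).1 =
        SymmetricAlgebra.ι ℂ M (φ v y • x - φ v x • y) * (n J).1 := by
    intro v J
    rw [koszulComponent, TensorProduct.lift.tmul, LinearMap.comp_apply, contraction_ιMulti]
    rfl
  have h2 : toPoly (koszulDifferential φ B B' k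
      fun J => exteriorPower.ιMulti ℂ 2 ![x, y] ⊗ₜ n J) =
      ∑ v, ∑ J : B', monomial (J.1 + Finsupp.single v 1)
        (SymmetricAlgebra.ι ℂ M (φ v y • x - φ v x • y) * (n J).1) := by
    rw [toPoly]
    simp only [koszulDifferential_apply, Submodule.coe_sum, map_sum]
    rw [Finset.sum_comm]
    refine Finset.sum_congr rfl fun v _ => ?_
    rw [Finset.sum_comm]
    refine Finset.sum_congr rfl fun J _ => ?_
    rw [Finset.sum_eq_single ⟨_, hB J.1 J.2 v⟩]
    · rw [if_pos rfl, h1]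
    · intro K _ hK
      rw [if_neg fun h => hK (Subtype.ext h.symm)]
      simp
    · simp
  rw [h2, koszulElement, map_linearForm, map_linearForm, Finset.mul_sum, Finset.mul_sum,
    ← Finset.sum_sub_distrib, toPoly, Finset.sum_mul]
  refine Finset.sum_congr rfl fun v _ => ?_
  rw [Finset.mul_sum]
  refine Finset.sum_congr rfl fun J _ => ?_
  rw [C_mul_monomial, C_mul_monomial, ← map_sub, monomial_mul, add_comm J.1]
  congr 2
  rw [map_sub, map_smul, map_smul, Algebra.smul_def, Algebra.smul_def, mul_comm (algebraMap _ _ _),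
    mul_comm (algebraMap _ _ _)]

theorem koszulDifferential_injective (φ : σ → M →ₗ[ℂ] ℂ)
    (hspan : ∀ m : M, ∃ a b : ℂ, m = a • x + b • y)
    (h0 : koszulElement x y (linearForm φ x) (linearForm φ y) ≠ 0)
    (hB : ∀ J ∈ B', ∀ v, J + Finsupp.single v 1 ∈ B) :
    Function.Injective (koszulDifferential φ B B' k) := by
  rw [injective_iff_map_eq_zero]
  intro t ht
  choose n hn using fun J => exists_eq_ιMulti_tmul hspan (t J)
  obtain rfl : t = fun J => exteriorPower.ιMulti ℂ 2 ![x, y] ⊗ₜ n J := funext hn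
  have h1 := toPoly_koszulDifferential φ x y hB n
  rw [ht] at h1
  have hz : ∀ C : Finset (σ →₀ ℕ), ∀ j, toPoly (0 : C → SymPart j M) = 0 := by
    intro C j
    simp [toPoly]
  rw [hz] at h1
  have h2 : toPoly n = toPoly (0 : B' → SymPart k M) := by
    rw [hz]
    exact (mul_eq_zero.1 h1.symm).resolve_left h0
  have h3 := toPoly_injective h2
  funext J
  rw [h3]
  exact TensorProduct.tmul_zero _ _

theorem koszulDifferential_exact (φ : σ → M →ₗ[ℂ] ℂ) {e : ℕ}
    (hspan : ∀ m : M, ∃ a b : ℂ, m = a • x + b • y)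
    (hx : Prime (linearForm φ x)) (hxy : ¬ linearForm φ x ∣ linearForm φ y)
    (hB : ∀ J, J ∈ B ↔ J.degree = e) (hB' : ∀ J, J ∈ B' ↔ J.degree + 1 = e) :
    Function.Exact (koszulDifferential φ B B' k)
      (multiplyForms (linearForm φ) B (k + 1)) := by
  have hBB : ∀ J ∈ B', ∀ v, J + Finsupp.single v 1 ∈ B := by
    intro J hJ v
    rw [hB, ← (hB' J).1 hJ, map_add, Finsupp.degree_single]
  intro s
  rw [multiplyForms_eq]
  constructor
  · intro hs
    obtain ⟨Q, hQ, hQk, hQe⟩ := exists_eq_koszulElement_mul (linearForm φ) hspan hx hxy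
      (linearForm_isHomogeneous φ x) (linearForm_isHomogeneous φ y) e k (toPoly s)
      (coeff_toPoly_mem s)
      (IsHomogeneous.sum _ _ _ fun J _ => isHomogeneous_monomial _ ((hB J.1).1 J.2)) hs
    obtain ⟨n, rfl⟩ := exists_toPoly_eq hQk fun J hJ => (hB' J).2 (hQe J hJ)
    refine ⟨fun J => exteriorPower.ιMulti ℂ 2 ![x, y] ⊗ₜ n J, toPoly_injective ?_⟩
    rw [toPoly_koszulDifferential φ x y hBB, hQ]
  · rintro ⟨t, rfl⟩
    choose n hn using fun J => exists_eq_ιMulti_tmul hspan (t J)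
    obtain rfl : t = fun J => exteriorPower.ιMulti ℂ 2 ![x, y] ⊗ₜ n J := funext hn
    rw [toPoly_koszulDifferential φ x y hBB, map_mul, multiplyOut_koszulElement, zero_mul]

end KoszulComplex

/-! ### The Koszul resolution of the bundle of vanishing polynomials -/

namespace Gr24

open MvPolynomial

/-- The coordinates of the linear forms in the fibre of `ν`. -/
def coord (l : Gr24) (v : Fin 4) : nu.fiber l →ₗ[ℂ] ℂ := evalAt l (Pi.single v 1)

/-- The fibre of `ν` at `l` as a space of polynomials. -/
abbrev nuForm (l : Gr24) : nu.fiber l →ₗ[ℂ] MvPolynomial (Fin 4) ℂ := linearForm (coord l)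

theorem eval_nuForm (l : Gr24) (φ : nu.fiber l) (w : Fin 4 → ℂ) :
    eval w (nuForm l φ) = φ.1 w := by
  rw [nuForm, linearForm_apply, map_sum]
  conv_rhs => rw [LinearMap.pi_apply_eq_sum_univ φ.1 w]
  refine Finset.sum_congr rfl fun v _ => ?_
  rw [smul_eval, eval_X, smul_eq_mul, mul_comm]
  refine congrArg (fun u => w v * φ.1 u) (_root_.funext fun a => ?_)
  simp [Pi.single_apply, eq_comm]

theorem nuForm_mem_vanishingIdeal (l : Gr24) (φ : nu.fiber l) :
    nuForm l φ ∈ vanishingIdeal ℂ (l.1 : Set (Fin 4 → ℂ)) := by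
  rw [mem_vanishingIdeal_iff]
  intro w hw
  change eval w (nuForm l φ) = 0
  rw [eval_nuForm]
  exact (Submodule.mem_dualAnnihilator φ.1).1 φ.2 w hw

/-- A product of `k` linear forms that vanish on `l` has degree `k` and vanishes on `l` to order
`k`. -/
theorem lift_nuForm_mem (l : Gr24) (k : ℕ) : ∀ s ∈ SymPart k (nu.fiber l),
    SymmetricAlgebra.lift (nuForm l) s ∈ vanishingPolys k k l := by
  induction k with
  | zero =>
    intro s hs
    rw [SymPart, pow_zero, Submodule.mem_one] at hs
    obtain ⟨c, rfl⟩ := hs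
    rw [AlgHom.commutes]
    exact ⟨isHomogeneous_C _ _, by simp⟩
  | succ k ih =>
    intro s hs
    rw [SymPart, pow_succ'] at hs
    refine Submodule.mul_induction_on hs ?_ fun s t hs ht => by
      rw [map_add]
      exact add_mem hs ht
    rintro _ ⟨φ, rfl⟩ t ht
    rw [map_mul, SymmetricAlgebra.lift_ι_apply]
    refine ⟨?_, ?_⟩
    · have h := (linearForm_isHomogeneous (coord l) φ).mul (ih t ht).1
      rwa [add_comm] at h
    · have h := Ideal.mul_mem_mul (nuForm_mem_vanishingIdeal l φ) (ih t ht).2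
      rwa [← pow_succ'] at h

/-- The fibre of `Symᵏν` at `l` maps to the forms of degree `k` that vanish on `l` to order `k`. -/
def symEval (k : ℕ) (l : Gr24) : SymPart k (nu.fiber l) →ₗ[ℂ] vanishingPolys k k l :=
  (((SymmetricAlgebra.lift (nuForm l)).toLinearMap ∘ₗ (SymPart k (nu.fiber l)).subtype).codRestrict
    (vanishingPolys k k l) fun s => lift_nuForm_mem l k s.1 s.2)

theorem isReg_symEval {k : ℕ} {l : Gr24} {s : ∀ m, SymPart k (nu.fiber m)}
    (hs : (symPow k nu).IsReg l s) : (vBundle k k).IsReg l fun m => symEval k m (s m) := by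
  classical
  refine GenReg.map (gen := symGen nu k) (vBundle k k) (fun m => symEval k m) ?_ hs
  rintro _ ⟨a, ha, rfl⟩
  have hprod : ∀ S : Finset (Fin k), ∀ K, (fun m => (∏ j ∈ S, nuForm m (a j m)).coeff K) ∈
      SpaceWithFunctions.regAt l := by
    intro S
    induction S using Finset.induction_on with
    | empty =>
      intro K
      simp only [Finset.prod_empty]
      exact const_regular _ _
    | insert j S hj ih =>
      intro K
      simp only [Finset.prod_insert hj, coeff_mul]
      have h : (∑ x ∈ Finset.HasAntidiagonal.antidiagonal K,
          (fun m => (nuForm m (a j m)).coeff x.1) *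
          fun m => (∏ j ∈ S, nuForm m (a j m)).coeff x.2) ∈ SpaceWithFunctions.regAt l := by
        refine sum_mem fun x _ => mul_mem ?_ (ih x.2)
        simp only [nuForm, linearForm_apply, coeff_sum, coeff_smul, smul_eq_mul]
        have h : (∑ v, (fun m => (a j m).1 (Pi.single v 1)) *
            fun _ => (X v : MvPolynomial (Fin 4) ℂ).coeff x.1) ∈ SpaceWithFunctions.regAt l :=
          sum_mem fun v _ => mul_mem (ha j _) (const_regular _ _)
        convert h using 1
        funext m
        rw [Finset.sum_apply]
        rfl
      convert h using 1
      funext m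
      rw [Finset.sum_apply]
      rfl
  intro K
  convert hprod Finset.univ K using 1
  funext m
  refine congrArg (coeff K) ?_
  change SymmetricAlgebra.lift (nuForm m) (∏ j, SymmetricAlgebra.ι ℂ _ (a j m)) = _
  rw [map_prod]
  simp only [SymmetricAlgebra.lift_ι_apply]

theorem mul_mem_vanishingPolys {k e : ℕ} {l : Gr24} {q p : MvPolynomial (Fin 4) ℂ}
    (hq : q.IsHomogeneous e) (hp : p ∈ vanishingPolys k k l) :
    q * p ∈ vanishingPolys k (k + e) l := by
  refine ⟨?_, Ideal.mul_mem_left _ _ hp.2⟩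
  have h := hq.mul hp.1
  rwa [add_comm] at h

/-- The exponents of the monomials of degree `e`. -/
abbrev exps (e : ℕ) : Finset (Fin 4 →₀ ℕ) := Finset.finsuppAntidiag Finset.univ e

/-- The exponents of the monomials of degree `e - 1`; there are none for `e = 0`. -/
def predExps : ℕ → Finset (Fin 4 →₀ ℕ)
  | 0 => ∅
  | e + 1 => exps e

theorem mem_exps {e : ℕ} (J : Fin 4 →₀ ℕ) : J ∈ exps e ↔ J.degree = e := by
  rw [Finset.mem_finsuppAntidiag, Finsupp.degree_eq_sum]
  simp

theorem mem_predExps {e : ℕ} (J : Fin 4 →₀ ℕ) : J ∈ predExps e ↔ J.degree + 1 = e := by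
  cases e with
  | zero => simp [predExps]
  | succ e => rw [predExps, mem_exps, Nat.succ_inj]

theorem card_exps (e : ℕ) : Fintype.card (exps e) = (e + 3).choose 3 := by
  rw [Fintype.card_coe, Finset.card_finsuppAntidiag_nat_eq_choose, Finset.card_univ,
    Fintype.card_fin, show 4 + e - 1 = e + 3 by omega, ← Nat.choose_symm_add]

theorem card_predExps (e : ℕ) : Fintype.card (predExps e) = (e + 2).choose 3 := by
  cases e with
  | zero => rfl
  | succ e => exact card_exps e

theorem multiplyForms_mem {k e : ℕ} {l : Gr24} (s : exps e → SymPart k (nu.fiber l)) :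
    multiplyForms (nuForm l) (exps e) k s ∈ vanishingPolys k (k + e) l := by
  rw [multiplyForms_apply]
  exact sum_mem fun J _ => mul_mem_vanishingPolys
    (isHomogeneous_monomial _ ((mem_exps J.1).1 J.2)) (lift_nuForm_mem l k _ (s J).2)

/-- The multiplication map `Symᵏν ⊗ S_e → V_{k,k+e}`. -/
def multiplyHom (k e : ℕ) : Hom (piBundle (exps e) (symPow k nu)) (vBundle k (k + e)) where
  toFun l := (multiplyForms (nuForm l) (exps e) k).codRestrict (vanishingPolys k (k + e) l)
    multiplyForms_mem
  map_reg l s hs K := by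
    classical
    have h : (∑ J : exps e, fun m => (monomial J.1 1 * (symEval k m (s m J)).1).coeff K) ∈
        SpaceWithFunctions.regAt l := by
      refine sum_mem fun J _ => ?_
      simp only [coeff_monomial_mul', one_mul]
      split_ifs
      · exact isReg_symEval (hs J) _
      · exact zero_mem _
    convert h using 1
    funext m
    rw [Finset.sum_apply, ← coeff_sum]
    exact congrArg (coeff K) (multiplyForms_apply (nuForm m) (s m))

/-- The Koszul differential `⋀²ν ⊗ Symᵏν ⊗ S_{e-1} → Symᵏ⁺¹ν ⊗ S_e`. -/
def koszulDifferentialHom (k e : ℕ) :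
    Hom (piBundle (predExps e) (tensor (extPow 2 nu) (symPow k nu)))
      (piBundle (exps e) (symPow (k + 1) nu)) where
  toFun l := koszulDifferential (coord l) (exps e) (predExps e) k
  map_reg l s hs K := by
    have h : (symPow (k + 1) nu).IsReg l fun m => ∑ v, ∑ J : predExps e,
        if J.1 + Finsupp.single v 1 = K.1 then koszulComponent k (coord m v) (s m J) else 0 := by
      refine IsReg.sum _ fun v _ => IsReg.sum _ fun J _ => ?_
      by_cases hJ : J.1 + Finsupp.single v 1 = K.1
      · exact ((koszulHom k (Pi.single v 1)).map_reg l _ (hs J)).congr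
          (Eventually.of_forall fun m => (if_pos hJ).symm)
      · exact (isReg_zero _).congr (Eventually.of_forall fun m => (if_neg hJ).symm)
    exact h.congr (Eventually.of_forall fun m => (koszulDifferential_apply (coord m) (s m) K).symm)

/-- The straightening substitution as an automorphism of the polynomial ring. -/
def sgEquiv (i j : Fin 4) (l : Gr24) : MvPolynomial (Fin 4) ℂ ≃ₐ[ℂ] MvPolynomial (Fin 4) ℂ :=
  AlgEquiv.ofAlgHom (sg i j l) (tu i j l) (AlgHom.ext (sg_tu i j l)) (AlgHom.ext (tu_sg i j l))

/-- The linear forms that cut out `l`, as elements of the fibre of `ν`. -/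
def nuFrame {l : Gr24} {i j : Fin 4} (h : l.plucker (i, j) ≠ 0) (a : Idx i j) : nu.fiber l :=
  ⟨form i j a.1 l, (Submodule.mem_dualAnnihilator _).2 fun v hv => by
    simpa [form] using vanish h a.2 hv⟩

theorem nuForm_nuFrame {l : Gr24} {i j : Fin 4} (h : l.plucker (i, j) ≠ 0) (a : Idx i j) :
    nuForm l (nuFrame h a) = sgEquiv i j l (X a.1) := by
  apply MvPolynomial.funext
  intro w
  rw [eval_nuForm]
  refine Eq.trans ?_ (congrArg (eval w) (sub_X i j a.1 _ _)).symm
  simp [nuFrame, form]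

/-- The forms that vanish on `l` to order `k` are combinations of straightened monomials with `k`
factors among the linear forms that cut out `l`; splitting off these factors gives an element of
`Symᵏν`. -/
theorem multiplyForms_surjective {l : Gr24} {k e : ℕ} (p : vanishingPolys k (k + e) l) :
    ∃ s, multiplyForms (nuForm l) (exps e) k s = p.1 := by
  obtain ⟨i, j, h⟩ := exists_plucker_ne l
  have hmul : ∀ (s : SymPart k (nu.fiber l)) (r : MvPolynomial (Fin 4) ℂ), r.IsHomogeneous e →
      r * SymmetricAlgebra.lift (nuForm l) s.1 ∈
        LinearMap.range (multiplyForms (nuForm l) (exps e) k) := by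
    intro s r hr
    refine ⟨fun J => r.coeff J.1 • s, ?_⟩
    rw [multiplyForms_apply]
    conv_rhs => rw [eq_sum_monomial hr, Finset.sum_mul]
    refine Finset.sum_congr rfl fun J _ => ?_
    rw [Submodule.coe_smul, map_smul, smul_mul_assoc, mul_smul_comm]
  have hfactor : ∀ (n : ℕ) (J : Fin 4 →₀ ℕ), n ≤ wt i j J → ∃ s ∈ SymPart n (nu.fiber l),
      ∃ J' : Fin 4 →₀ ℕ, n + J'.degree = J.degree ∧ sg i j l (monomial J 1) =
        sg i j l (monomial J' 1) * SymmetricAlgebra.lift (nuForm l) s := by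
    intro n
    induction n with
    | zero =>
      intro J _
      exact ⟨1, by simp [SymPart], J, by simp, by simp⟩
    | succ n ih =>
      intro J hJ
      obtain ⟨a, -, ha⟩ : ∃ a ∈ (Finset.univ : Finset (Idx i j)), J a.1 ≠ 0 :=
        Finset.exists_ne_zero_of_sum_ne_zero (f := fun a : Idx i j => J a.1)
          (Nat.ne_of_gt (Nat.lt_of_lt_of_le n.succ_pos hJ))
      obtain ⟨J₁, rfl⟩ : ∃ J₁, J = Finsupp.single a.1 1 + J₁ :=
        ⟨J - Finsupp.single a.1 1, (add_tsub_cancel_of_le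
          (Finsupp.single_le_iff.2 (Nat.one_le_iff_ne_zero.2 ha))).symm⟩
      have hwt : wt i j (Finsupp.single a.1 1 + J₁) = 1 + wt i j J₁ := by
        simp only [wt, Finsupp.add_apply, Finset.sum_add_distrib]
        congr 1
        rw [Finset.sum_eq_single a]
        · simp
        · intro b _ hb
          exact Finsupp.single_eq_of_ne fun h => hb (Subtype.ext h)
        · simp
      obtain ⟨s, hs, J', hd, hJ'⟩ := ih J₁ (by omega)
      refine ⟨_, ι_mul_mem_symPart (nuFrame h a) hs, J', ?_, ?_⟩
      · rw [map_add, Finsupp.degree_single]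
        omega
      · rw [map_mul, SymmetricAlgebra.lift_ι_apply, nuForm_nuFrame, mul_left_comm, ← hJ',
          ← one_mul (1 : ℂ), ← monomial_mul, map_mul, one_mul]
        rfl
  change p.1 ∈ LinearMap.range (multiplyForms (nuForm l) (exps e) k)
  rw [eq_sum_sg h p.2]
  refine sum_mem fun J _ => Submodule.smul_mem _ _ ?_
  obtain ⟨s, hs, J', hd, hJ'⟩ := hfactor k J.1.1 J.2
  rw [hJ']
  refine hmul ⟨s, hs⟩ _ (sub_homogeneous (isHomogeneous_monomial _ ?_))
  have := (mem_exps J.1.1).1 J.1.2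
  omega

theorem exists_idx {i j : Fin 4} (h : i ≠ j) :
    ∃ a b : Idx i j, a ≠ b ∧ ∀ c : Idx i j, c = a ∨ c = b := by
  revert i j
  decide

/-- The Koszul resolution `0 → ⋀²ν ⊗ Symᵏν ⊗ S_{e-1} → Symᵏ⁺¹ν ⊗ S_e → V_{k+1,k+1+e} → 0`. -/
theorem isShortExact_koszul (k e : ℕ) :
    IsShortExact (koszulDifferentialHom k e) (multiplyHom (k + 1) e) := by
  intro l
  obtain ⟨i, j, h⟩ := exists_plucker_ne l
  obtain ⟨a, b, hab, hc⟩ := exists_idx (plucker_ne_idx h)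
  have hspan : ∀ φ : nu.fiber l, ∃ c d : ℂ, φ = c • nuFrame h a + d • nuFrame h b := by
    intro φ
    refine ⟨φ.1 (Pi.single a.1 1), φ.1 (Pi.single b.1 1), Subtype.ext ?_⟩
    refine (eq_sum_form h φ.2).trans ?_
    have huniv : (Finset.univ : Finset (Idx i j)) = {a, b} := by
      ext c
      simpa using hc c
    rw [huniv, Finset.sum_pair hab]
    rfl
  have hx : Prime (nuForm l (nuFrame h a)) := by
    rw [nuForm_nuFrame]
    exact (MulEquiv.prime_iff (sgEquiv i j l)).2 X_prime
  have hxy : ¬ nuForm l (nuFrame h a) ∣ nuForm l (nuFrame h b) := by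
    rw [nuForm_nuFrame, nuForm_nuFrame, map_dvd_iff, X_dvd_X]
    exact fun h => hab (Subtype.ext h)
  have h0 : koszulElement (nuFrame h a) (nuFrame h b) (nuForm l (nuFrame h a))
      (nuForm l (nuFrame h b)) ≠ 0 := by
    refine koszulElement_ne_zero (J := Finsupp.single a.1 1) (fun hy => hxy ?_) ?_ ?_
    · rw [hy, map_zero]
      exact dvd_zero _
    · rw [coeff_linearForm]
      exact (form_single a.2 l).trans (if_pos rfl)
    · rw [coeff_linearForm]
      exact (form_single a.2 l).trans (if_neg fun h => hab (Subtype.ext h.symm))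
  refine ⟨?_, ?_, ?_⟩
  · refine koszulDifferential_injective (coord l) hspan h0 fun J hJ v => ?_
    rw [mem_exps, ← (mem_predExps J).1 hJ, map_add, Finsupp.degree_single]
  · intro s
    refine Iff.trans ?_ (koszulDifferential_exact (coord l) hspan hx hxy mem_exps mem_predExps s)
    exact Subtype.ext_iff
  · intro p
    obtain ⟨s, hs⟩ := multiplyForms_surjective p
    exact ⟨s, Subtype.ext hs⟩

/-- A form of degree `d` does not vanish to an order above `d`, unless it is zero. -/
theorem cls_vBundle_of_lt {k d : ℕ} (h : d < k) : K0.cls (vBundle k d) = 0 := by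
  have hz : ∀ (l : Gr24) (p : vanishingPolys k d l), p = 0 := by
    intro l p
    obtain ⟨i, j, hp⟩ := exists_plucker_ne l
    apply Subtype.ext
    rw [eq_sum_sg hp p.2]
    refine Finset.sum_eq_zero fun J _ => ?_
    have h1 : wt i j J.1.1 ≤ ∑ a, J.1.1 a := by
      rw [wt, ← Finset.sum_subtype (Finset.univ.filter fun a => a ≠ i ∧ a ≠ j) (by simp)
        fun a => J.1.1 a]
      exact Finset.sum_le_sum_of_subset (Finset.filter_subset _ _)
    have h2 := J.2
    have h3 : ∑ a, J.1.1 a = d := (Finset.mem_finsuppAntidiag.1 J.1.2).1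
    omega
  rw [← K0.cls_zeroBundle]
  exact K0.cls_eq_of_bijective (E := vBundle k d) (F := zeroBundle Gr24)
    ⟨fun _ => 0, fun _ _ _ => trivial⟩ fun l =>
      ⟨fun p q _ => (hz l p).trans (hz l q).symm, fun _ => ⟨0, rfl⟩⟩

end Gr24

/-! ### The formula in the Grothendieck ring -/

theorem binom_natCast (n r : ℕ) : binom n r = n.choose r := by
  simp [binom]

theorem binom_of_lt {n : ℤ} {r : ℕ} (h : n < r) : binom n r = 0 := by
  unfold binom
  split_ifs
  · exact Nat.choose_eq_zero_of_lt (by omega)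
  · rfl

end

theorem mainTheorem4 (k d : ℕ) (hk : 1 ≤ k) :
    K0.cls (Gr24.vBundle k d) =
      binom ((d : ℤ) - k + 3) 3 • K0.cls (AlgVectorBundle.symPow k Gr24.nu) -
        binom ((d : ℤ) - k + 2) 3 • (K0.cls (AlgVectorBundle.extPow 2 Gr24.nu) *
          K0.cls (AlgVectorBundle.symPow (k - 1) Gr24.nu)) := by
  rcases lt_or_ge d k with h | h
  · rw [Gr24.cls_vBundle_of_lt h, binom_of_lt (by push_cast; omega),
      binom_of_lt (by push_cast; omega), zero_smul, zero_smul, sub_zero]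
  · obtain ⟨k, rfl⟩ := Nat.exists_eq_add_of_le' hk
    obtain ⟨e, rfl⟩ := Nat.exists_eq_add_of_le h
    have h3 : ((k + 1 + e : ℕ) : ℤ) - (k + 1 : ℕ) + 3 = (e + 3 : ℕ) := by push_cast; ring
    have h2 : ((k + 1 + e : ℕ) : ℤ) - (k + 1 : ℕ) + 2 = (e + 2 : ℕ) := by push_cast; ring
    rw [h3, h2, binom_natCast, binom_natCast, Nat.add_sub_cancel, K0.cls_mul_cls,
      ← Gr24.card_exps, ← Gr24.card_predExps, ← AlgVectorBundle.cls_piBundle,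
      ← AlgVectorBundle.cls_piBundle,
      K0.cls_exact _ _ (Gr24.isShortExact_koszul k e), add_sub_cancel_left]
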